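/- **Conventions.** For a cardinal $\chi$, $\mathcal H_\chi$ is the set of all sets whose transitive closure has size $<\chi$, and $\mathcal M_\chi$ is the set of elementary submodels $M$ of $(\mathcal H_\chi,\in)$ such that $|M|=\aleph_1$ and $[M]^{\aleph_0}\cap M$ is cofinal in $([M]^{\aleph_0},\subseteq)$. For a subalgebra $A$ of a Boolean algebra $B$ and $b\in B$, let $A\restriction b=\{a\in A: a\le b\}$. Write $A\le_{sep}B$ if for every $b\in B$ and every uncountable $T\subseteq A\restriction b$ there is $a\in A\restriction b$ such that $\{c\in T:c\le a\}$ is uncountable; write $A\le_\sigma B$ if for every $b\in B$ the set $A\restriction b$ has a countable cofinal subset. For a Boolean algebra $A$: * $\operatorname{SEP}(A)$ means that for all sufficiently large regular $\chi$, for every $X\subseteq\mathcal H_\chi$ with $|X|=\aleph_1$ there is $M\in\mathcal M_\chi$ with $X\subseteq M$ and $A\cap M\le_{sep}A$; * $\operatorname{IDP}(A)$ means that for all sufficiently large regular $\chi$ and all $M\in\mathcal M_\chi$ with $A\in M$ (that is, the structure $(A,\vee,\wedge,-,0,1)$ is an element of $M$), $A\cap M\le_\sigma A$. (Both $A\cap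 M\le_{sep}A$ and $A\cap M\le_\sigma A$ include that $A\cap M$ is a subalgebra of $A$.) Let $E=\{\alpha<\omega_2:\operatorname{cf}(\alpha)=\aleph_1\}$. A *ladder system* $\delta$ assigns to every $\alpha\in E$ a strictly increasing sequence $(\delta^\alpha_\beta)_{\beta<\omega_1}$ of successor ordinals that is cofinal in $\alpha$. For $S\subseteq E$ and a ladder system $\delta$, the Boolean algebra $A^S$ is $\bigcup_{\alpha<\omega_2}A^S_\alpha$, where the increasing chain of subalgebras $A^S_\alpha$ and elements $x_\alpha$ $(\alpha<\omega_2)$ satisfy: * $A^S_0=\{0,1\}$ with $0\ne1$, and $A^S_\alpha=\bigcup_{\beta<\alpha}A^S_\beta$ for limit $\alpha$; * $A^S_{\alpha+1}=A^S_\alpha(x_\alpha)$ is generated by $A^S_\alpha\cup\{x_\alpha\}$; * if $\alpha\notin S$, then $x_\alpha$ is independent over $A^S_\alpha$, i.e. $a\wedge x_\alpha\ne0\ne a\wedge -x_\alpha$ for all nonzero $a\in A^S_\alpha$; * if $\alpha\in S$, then $x_\alpha\notin A^S_\alpha$, $A^S_\alpha\restriction x_\alpha$ is the ideal of $A^S_\alpha$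 generated by $\{x_{\delta^\alpha_\beta}:\beta<\omega_1\}$, and $A^S_\alpha\restriction -x_\alpha=\{0\}$. **Theorem 6.4** (ZFC). There is a Boolean algebra $A$ with $\operatorname{SEP}(A)$ but not $\operatorname{IDP}(A)$. More precisely, there are disjoint stationary subsets $S_0,S_1$ of $\omega_2$ with $S_0\cup S_1=E$, and there are ladder systems; and for any such $S_0,S_1$ and any ladder system, the algebra $A^{S_1}$ exists, and every such algebra $A=A^{S_1}$ satisfies $\operatorname{SEP}(A)$ but not $\operatorname{IDP}(A)$. -/

import Mathlib

open Cardinal Ordinal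

universe u

/-! ### The structure `(H_χ, ∈)` and its good elementary submodels -/

/-- The relation symbols of the language of set theory: a single binary symbol. -/
inductive MemRel : ℕ → Type
  | mem : MemRel 2

/-- The first-order language of set theory. -/
def setLang : FirstOrder.Language :=
  ⟨fun _ => Empty, MemRel⟩

/-- `H_χ`: the sets whose transitive closure has cardinality less than `χ`, that is, the sets
included in a transitive set of cardinality less than `χ`. -/
def hereditarySets (χ : Cardinal.{u}) : Set ZFSet.{u} :=
  {x | ∃ t : ZFSet.{u}, t.IsTransitive ∧ x ⊆ t ∧ t.card < χ}

/-- `H_χ` as a structure for the language of set theory. -/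
instance hereditarySetsStructure (χ : Cardinal.{u}) : setLang.Structure (hereditarySets χ) where
  funMap := fun f => nomatch f
  RelMap := fun r =>
    match r with
    | MemRel.mem => fun v => (v 0 : ZFSet.{u}) ∈ (v 1 : ZFSet.{u})

/-- `M` is the underlying set of an elementary submodel of `(H_χ, ∈)`. -/
def IsElementarySubmodel (χ : Cardinal.{u}) (M : Set ZFSet.{u}) : Prop :=
  ∃ N : setLang.ElementarySubstructure (hereditarySets χ),
    M = Subtype.val '' (N : Set (hereditarySets χ))

/-- The set of elementary submodels `M` of `H_χ` such that `|M| = ℵ₁` and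
`[M]^ℵ₀ ∩ M` is cofinal in `[M]^ℵ₀`. -/
def goodSubmodels (χ : Cardinal.{u}) : Set (Set ZFSet.{u}) :=
  {M | IsElementarySubmodel χ M ∧ #M = ℵ₁ ∧
    ∀ X : Set ZFSet.{u}, X ⊆ M → #X = ℵ₀ →
      ∃ y : ZFSet.{u}, y ∈ M ∧ (y : Set ZFSet.{u}) ⊆ M ∧ #(y : Set ZFSet.{u}) = ℵ₀ ∧
        X ⊆ (y : Set ZFSet.{u})}

/-! ### The embeddings `≤_sep` and `≤_σ` -/

/-- `A ≤_sep B`: for every `b ∈ B`, every uncountable subset `T` of `A ↾ b = {a ∈ A | a ≤ b}` has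
uncountably many elements below a single element of `A ↾ b`. -/
def SepEmbedded {B : Type*} [BooleanAlgebra B] (A : BooleanSubalgebra B) : Prop :=
  ∀ (b : B) (T : Set B), T ⊆ {a | a ∈ A ∧ a ≤ b} → ¬ T.Countable →
    ∃ a, a ∈ A ∧ a ≤ b ∧ ¬ {c | c ∈ T ∧ c ≤ a}.Countable

/-- `A ≤_σ B`: for every `b ∈ B`, `A ↾ b = {a ∈ A | a ≤ b}` has a countable cofinal subset. -/
def SigmaEmbedded {B : Type*} [BooleanAlgebra B] (A : BooleanSubalgebra B) : Prop :=
  ∀ b : B, ∃ C : Set B, C.Countable ∧ C ⊆ {a | a ∈ A ∧ a ≤ b} ∧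
    ∀ a ∈ A, a ≤ b → ∃ c ∈ C, a ≤ c

/-! ### Boolean algebras as sets, SEP and IDP -/

/-- A Boolean algebra whose underlying set is a set of the universe `ZFSet`. -/
structure SetBooleanAlgebra where
  carrier : ZFSet.{u}
  [str : BooleanAlgebra carrier]

attribute [instance] SetBooleanAlgebra.str

namespace SetBooleanAlgebra

/-- The structure `(A, ∨, ∧, ¬, 0, 1)` as a single set, where the operations are identified with
their graphs. -/
noncomputable def code (A : SetBooleanAlgebra.{u}) : ZFSet.{u} :=
  .pair A.carrier <|
  .pair (.range fun p : A.carrier × A.carrier =>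
    .pair (.pair p.1.1 p.2.1) (p.1 ⊔ p.2 : A.carrier).1) <|
  .pair (.range fun p : A.carrier × A.carrier =>
    .pair (.pair p.1.1 p.2.1) (p.1 ⊓ p.2 : A.carrier).1) <|
  .pair (.range fun a : A.carrier => .pair a.1 (aᶜ : A.carrier).1) <|
  .pair (⊥ : A.carrier).1 (⊤ : A.carrier).1

/-- `A ∩ M ≤_sep A`, which includes that `A ∩ M` is a subalgebra of `A`. -/
def TraceSep (A : SetBooleanAlgebra.{u}) (M : Set ZFSet.{u}) : Prop :=
  ∃ N : BooleanSubalgebra A.carrier,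
    (N : Set A.carrier) = {a : A.carrier | (a : ZFSet.{u}) ∈ M} ∧ SepEmbedded N

/-- `A ∩ M ≤_σ A`, which includes that `A ∩ M` is a subalgebra of `A`. -/
def TraceSigma (A : SetBooleanAlgebra.{u}) (M : Set ZFSet.{u}) : Prop :=
  ∃ N : BooleanSubalgebra A.carrier,
    (N : Set A.carrier) = {a : A.carrier | (a : ZFSet.{u}) ∈ M} ∧ SigmaEmbedded N

/-- `SEP(A)`: for all sufficiently large regular `χ`, the good `M` with `A ∩ M ≤_sep A` are
cofinal in `[H_χ]^ℵ₁`. -/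
def SEP (A : SetBooleanAlgebra.{u}) : Prop :=
  ∃ κ : Cardinal.{u}, ∀ χ : Cardinal.{u}, κ < χ → χ.IsRegular →
    ∀ X : Set ZFSet.{u}, X ⊆ hereditarySets χ → #X = ℵ₁ →
      ∃ M ∈ goodSubmodels χ, X ⊆ M ∧ A.TraceSep M

/-- `IDP(A)`, the `(ℵ₁, ℵ₀)`-ideal property: for all sufficiently large regular `χ` and all good
`M` with `A ∈ M`, `A ∩ M ≤_σ A`. -/
def IDP (A : SetBooleanAlgebra.{u}) : Prop :=
  ∃ κ : Cardinal.{u}, ∀ χ : Cardinal.{u}, κ < χ → χ.IsRegular →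
    ∀ M ∈ goodSubmodels χ, A.code ∈ M → A.TraceSigma M

end SetBooleanAlgebra

/-! ### The algebras `A^S` -/

/-- The set of ordinals below `ω₂` of cofinality `ℵ₁`. -/
def cofOmegaOne : Set Ordinal.{u} :=
  {α | α < ω_ 2 ∧ α.cof = ℵ₁}

/-- `S` meets every closed unbounded subset of `ω₂`. -/
def IsStationaryInOmegaTwo (S : Set Ordinal.{u}) : Prop :=
  IsStationary (Subtype.val ⁻¹' S : Set (Set.Iio (ω_ 2 : Ordinal.{u})))

/-- `S₀` and `S₁` partition the set of ordinals below `ω₂` of cofinality `ℵ₁` into two stationary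
subsets of `ω₂`. -/
structure IsStationaryPartition (S₀ S₁ : Set Ordinal.{u}) : Prop where
  disjoint : Disjoint S₀ S₁
  union_eq : S₀ ∪ S₁ = cofOmegaOne
  stationary_left : IsStationaryInOmegaTwo S₀
  stationary_right : IsStationaryInOmegaTwo S₁

/-- For every `α < ω₂` of cofinality `ℵ₁`, `(δ α β)_{β < ω₁}` is an increasing sequence of
successor ordinals that is cofinal in `α`. -/
structure IsLadderSystem (δ : Ordinal.{u} → Ordinal.{u} → Ordinal.{u}) : Prop where
  strictMono : ∀ α ∈ cofOmegaOne, StrictMonoOn (δ α) (Set.Iio (ω_ 1))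
  lt : ∀ α ∈ cofOmegaOne, ∀ β < ω_ 1, δ α β < α
  cofinal : ∀ α ∈ cofOmegaOne, ∀ γ < α, ∃ β < ω_ 1, γ ≤ δ α β
  succ : ∀ α ∈ cofOmegaOne, ∀ β < ω_ 1, ∃ γ, δ α β = Order.succ γ

/-- `B` is the union of the increasing chain `(A α)_{α < ω₂}` of subalgebras, built by recursion
with the generators `(x α)_{α < ω₂}` as in the definition of the algebra `A^S`
(for the ladder system `δ`). -/
structure IsConstruction (S : Set Ordinal.{u}) (δ : Ordinal.{u} → Ordinal.{u} → Ordinal.{u})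
    {B : Type*} [BooleanAlgebra B] (A : Ordinal.{u} → BooleanSubalgebra B)
    (x : Ordinal.{u} → B) : Prop where
  bot_ne_top : (⊥ : B) ≠ ⊤
  /-- `A 0 = {0, 1}`. -/
  zero : (A 0 : Set B) = {⊥, ⊤}
  limit : ∀ α < ω_ 2, Order.IsSuccLimit α → (A α : Set B) = ⋃ β ∈ Set.Iio α, (A β : Set B)
  /-- `A (α + 1) = (A α)(x α)`. -/
  succ : ∀ α < ω_ 2, A (Order.succ α) = BooleanSubalgebra.closure (insert (x α) (A α : Set B))
  /-- For `α ∉ S`, `x α` is independent over `A α`. -/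
  independent : ∀ α < ω_ 2, α ∉ S → ∀ a ∈ A α, a ≠ ⊥ → a ⊓ x α ≠ ⊥ ∧ a ⊓ (x α)ᶜ ≠ ⊥
  notMem : ∀ α < ω_ 2, α ∈ S → x α ∉ A α
  /-- For `α ∈ S`, the ideal `A α ↾ x α` of `A α` is generated by `{x (δ α β) | β < ω₁}`. -/
  below : ∀ α < ω_ 2, α ∈ S → ∀ a ∈ A α, (a ≤ x α ↔
    ∃ t : Finset Ordinal.{u}, (∀ β ∈ t, β < ω_ 1) ∧ a ≤ t.sup fun β => x (δ α β))
  /-- For `α ∈ S`, `A α ↾ -x α = {0}`. -/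
  below_compl : ∀ α < ω_ 2, α ∈ S → ∀ a ∈ A α, a ≤ (x α)ᶜ → a = ⊥
  exhaust : ∀ b : B, ∃ α < ω_ 2, b ∈ A α

/-- The Boolean algebra `B` is (a copy of) the algebra `A^S` built with the ladder system `δ`. -/
def IsLadderAlgebra (S : Set Ordinal.{u}) (δ : Ordinal.{u} → Ordinal.{u} → Ordinal.{u})
    (B : Type*) [BooleanAlgebra B] : Prop :=
  ∃ (A : Ordinal.{u} → BooleanSubalgebra B) (x : Ordinal.{u} → B), IsConstruction S δ A x

universe v

/-! The subalgebras `A α` have size at most `ℵ₁` and exhaust the algebra. Take an increasing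
`ω₂`-chain of elementary submodels of size `ℵ₁`, the `η`-th containing `A η` and countable covers of
all countable subsets of earlier models. If `ξ` has cofinality `ℵ₁`, the union of the models before
`ξ` is good, since a countable subset already lies in one of them. For club many `ξ`, elements
captured before `ξ` belong to stages before `ξ`, so at such a `ξ` of cofinality `ℵ₁` the trace of
the union is exactly `A ξ`. A stationary subset of `cofOmegaOne` meets this club
(`exists_goodSubmodel_trace`), so both properties reduce to how `A ξ` sits in the algebra.

If `ξ ∈ S₁`, the ideal below `x ξ` is generated by an `ω₁`-sequence of independent generators and
has no countable cofinal subset (`not_sigmaEmbedded`); this refutes IDP. If `ξ ∈ S₀`, then `ξ ∉ S₁`,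
and `sepAt_of_mem` shows `A ξ ≤_sep A`: at each later stage of `S₁` only countably many ladder
points matter, and an uncountable family can be thinned to share one finite set of them.

The algebra exists as an algebra of sets over the space `ladderSpace`, and Ulam's matrix splits
`cofOmegaOne`. -/

/-! ### Cardinality and cofinality at `ω₂`. -/

theorem cof_omega_two : (ω_ 2 : Ordinal.{u}).cof = ℵ_ 2 := by
  have := cof_omega_add_one.{u} 1
  rwa [one_add_one_eq_two] at this

theorem aleph_two_eq_succ : (ℵ_ 2 : Cardinal.{u}) = Order.succ ℵ₁ := by
  rw [← one_add_one_eq_two, succ_aleph]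

theorem card_le_of_lt_omega_two {α : Ordinal.{u}} (h : α < ω_ 2) : α.card ≤ ℵ₁ := by
  rw [← ord_aleph, lt_ord, aleph_two_eq_succ] at h
  exact Order.lt_succ_iff.1 h

theorem omega_one_lt_omega_two : (ω_ 1 : Ordinal.{u}) < ω_ 2 := by
  rw [omega_lt_omega]; exact one_lt_two

theorem isSuccLimit_omega_two : Order.IsSuccLimit (ω_ 2 : Ordinal.{u}) :=
  isSuccLimit_omega _

theorem mk_Iio_le_of_lt_omega_two {α : Ordinal.{u}} (h : α < ω_ 2) : #(Set.Iio α) ≤ ℵ₁ := by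
  rw [Cardinal.mk_Iio_ordinal]
  simpa using Cardinal.lift_le.{u + 1}.2 (card_le_of_lt_omega_two h)

theorem mk_Iio_omega_one : #(Set.Iio (ω_ 1 : Ordinal.{u})) = ℵ₁ := by
  rw [Cardinal.mk_Iio_ordinal]; simp

theorem mk_Iio_omega_two : #(Set.Iio (ω_ 2 : Ordinal.{u})) = ℵ_ 2 := by
  rw [Cardinal.mk_Iio_ordinal]; simp

theorem aleph_one_lt_aleph_two : (ℵ₁ : Cardinal.{u}) < ℵ_ 2 := by
  rw [aleph_lt_aleph]; exact one_lt_two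

theorem iSup_lt_omega_two {ι : Type v} (hι : #ι ≤ ℵ₁) {f : ι → Ordinal.{u}}
    (hf : ∀ i, f i < ω_ 2) : ⨆ i, f i < ω_ 2 := by
  refine lift_iSup_lt_of_lt_cof ?_ hf
  rw [← lift_cof, cof_omega_two]
  have := Cardinal.lift_le.{u}.2 hι
  refine this.trans_lt ?_
  simp

theorem le_iSup_of_mk_le {ι : Type v} (hι : #ι ≤ ℵ₁) (f : ι → Ordinal.{u}) (i : ι) :
    f i ≤ ⨆ i, f i := by
  have : Small.{u} ι := by
    have h : Cardinal.lift.{u} #ι ≤ Cardinal.lift.{v} #(ℵ₁ : Cardinal.{u}).out := by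
      simpa using Cardinal.lift_le.{u}.2 hι
    obtain ⟨e⟩ := Cardinal.lift_mk_le'.1 h
    exact small_of_injective e.injective
  exact Ordinal.le_iSup f i

theorem isSuccLimit_of_mem_cofOmegaOne {α : Ordinal.{u}} (h : α ∈ cofOmegaOne) :
    Order.IsSuccLimit α := by
  rw [← one_lt_cof_iff, h.2]
  exact one_lt_aleph0.trans aleph0_lt_aleph_one

/-- A countable subset of an ordinal of cofinality `ℵ₁` is bounded. -/
theorem exists_bound_of_countable {α : Ordinal.{u}} (hα : α.cof = ℵ₁) {s : Set Ordinal.{u}}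
    (hs : s.Countable) (h : ∀ β ∈ s, β < α) : ∃ γ < α, ∀ β ∈ s, β < γ := by
  have hlim : Order.IsSuccLimit α := by
    rw [← one_lt_cof_iff, hα]
    exact one_lt_aleph0.trans aleph0_lt_aleph_one
  have hlt : sSup s < α := by
    refine sSup_lt_of_lt_cof ?_ h
    rw [← lift_cof, hα]
    refine (Cardinal.le_aleph0_iff_set_countable.2 hs).trans_lt ?_
    simp
  refine ⟨Order.succ (sSup s), hlim.succ_lt hlt, fun β hβ => Order.lt_succ_iff.2 ?_⟩
  exact le_csSup ⟨α, fun β hβ => (h β hβ).le⟩ hβ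

/-! ### Ladder systems. -/

theorem exists_isLadderSystem : ∃ δ : Ordinal.{u} → Ordinal.{u} → Ordinal.{u},
    IsLadderSystem δ := by
  have key : ∀ α : Ordinal.{u}, ∃ d : Ordinal.{u} → Ordinal.{u}, α ∈ cofOmegaOne →
      StrictMonoOn d (Set.Iio (ω_ 1)) ∧ (∀ β < ω_ 1, d β < α) ∧
      (∀ γ < α, ∃ β < ω_ 1, γ ≤ d β) ∧ (∀ β < ω_ 1, ∃ γ, d β = Order.succ γ) := by
    intro α
    by_cases hα : α ∈ cofOmegaOne
    · have hlim := isSuccLimit_of_mem_cofOmegaOne hα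
      obtain ⟨f, hf⟩ := exists_isFundamentalSeq (o := α) (a := ω_ 1) (by rw [hα.2, ord_aleph])
      refine ⟨fun β => if h : β < ω_ 1 then Order.succ (f ⟨β, h⟩).1 else 0, fun _ => ?_⟩
      refine ⟨?_, ?_, ?_, ?_⟩
      · intro β hβ γ hγ h
        rw [Set.mem_Iio] at hβ hγ
        simp only [hβ, hγ, dif_pos]
        exact Order.succ_lt_succ (hf.strictMono (show (⟨β, hβ⟩ : Set.Iio _) < ⟨γ, hγ⟩ from h))
      · intro β hβ
        simp only [hβ, dif_pos]
        exact hlim.succ_lt (f ⟨β, hβ⟩).2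
      · intro γ hγ
        obtain ⟨_, ⟨β, rfl⟩, hβ⟩ := hf.isCofinal_range ⟨γ, hγ⟩
        refine ⟨β, β.2, ?_⟩
        have h := β.2
        rw [Set.mem_Iio] at h
        simp only [h, dif_pos]
        exact le_trans hβ (Order.le_succ _)
      · intro β hβ
        exact ⟨(f ⟨β, hβ⟩).1, by simp only [hβ, dif_pos]⟩
    · exact ⟨id, fun h => (hα h).elim⟩
  choose δ hδ using key
  exact ⟨δ, fun α h => (hδ α h).1, fun α h => (hδ α h).2.1, fun α h => (hδ α h).2.2.1,
    fun α h => (hδ α h).2.2.2⟩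

/-! ### Closure points of functions on `ω₂`. -/

section Closure

variable {g : Ordinal.{u} → Ordinal.{u}}

/-- The iterated function exceeds its argument and has no fixed point; `nfp` serves only as the
supremum of its iterates, and `g` sends anything below one iterate below the next. -/
theorem lt_nfp_of_lt_nfp (hg : Monotone g) {a η : Ordinal.{u}}
    (h : η < nfp (fun b => max (Order.succ b) (Order.succ (g b))) a) :
    g η < nfp (fun b => max (Order.succ b) (Order.succ (g b))) a := by
  rw [lt_nfp_iff] at h ⊢
  obtain ⟨n, hn⟩ := h
  refine ⟨n + 1, ?_⟩
  rw [Function.iterate_succ_apply']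
  exact lt_max_of_lt_right ((hg hn.le).trans_lt (Order.lt_succ _))

/-- A function on `ω₂` has closure points of cofinality `ℵ₁` above every ordinal. -/
theorem exists_closurePoint (hg : Monotone g) (hg2 : ∀ η < ω_ 2, g η < ω_ 2) :
    ∃ ξ ∈ cofOmegaOne, ∀ η < ξ, g η < ξ := by
  set f : Ordinal.{u} → Ordinal.{u} := fun b => max (Order.succ b) (Order.succ (g b)) with hf
  have hf2 : ∀ i < (ℵ_ 2 : Cardinal.{u}).ord, f i < (ℵ_ 2 : Cardinal.{u}).ord := by
    rw [ord_aleph]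
    intro i hi
    exact max_lt (isSuccLimit_omega_two.succ_lt hi) (isSuccLimit_omega_two.succ_lt (hg2 i hi))
  have hreg : (ℵ_ 2 : Cardinal.{u}).IsRegular := by
    have := isRegular_aleph_add_one.{u} 1
    rwa [one_add_one_eq_two] at this
  have hne : (ℵ_ 2 : Cardinal.{u}) ≠ ℵ₀ :=
    (aleph0_lt_aleph_one.trans aleph_one_lt_aleph_two).ne'
  have hlim : Order.IsSuccLimit (ω_ 1 : Ordinal.{u}) := isSuccLimit_omega _
  -- `deriv f` is just a normal sequence whose successor values are closed under `g`; its value at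
  -- `ω₁` inherits cofinality `ℵ₁`.
  have hnorm : Order.IsNormal (deriv f) := isNormal_deriv f
  refine ⟨deriv f (ω_ 1), ⟨?_, ?_⟩, ?_⟩
  · have := deriv_lt_ord hreg hne hf2 (a := ω_ 1) (by
      rw [ord_aleph]; exact omega_one_lt_omega_two)
    rwa [ord_aleph] at this
  · rw [cof_map_of_isNormal hnorm hlim]
    exact cof_omega_one
  · intro η hη
    obtain ⟨i, hi, hηi⟩ := (hnorm.lt_iff_exists_lt hlim).1 hη
    have hlt : deriv f i < deriv f (Order.succ i) := hnorm.strictMono (Order.lt_succ i)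
    have h2 : η < deriv f (Order.succ i) := hηi.trans hlt
    rw [deriv_succ] at h2
    have h3 := lt_nfp_of_lt_nfp hg h2
    rw [← hf, ← deriv_succ] at h3
    exact h3.trans_le (hnorm.strictMono.monotone (hlim.succ_lt hi).le)

theorem isClub_closurePoints (hg : Monotone g) (hg2 : ∀ η < ω_ 2, g η < ω_ 2) :
    IsClub {ξ : Set.Iio (ω_ 2 : Ordinal.{u}) | ∀ η < ξ.1, g η < ξ.1} := by
  constructor
  · intro d hd hne _ a ha η hη
    have : ∃ ξ ∈ d, η < ξ.1 := by
      by_contra! h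
      have hη2 : η < ω_ 2 := hη.trans a.2
      exact hη.not_ge (ha.2 (show (⟨η, hη2⟩ : Set.Iio (ω_ 2)) ∈ upperBounds d from
        fun ξ hξ => h ξ hξ))
    obtain ⟨ξ, hξ, h⟩ := this
    exact (hd hξ η h).trans_le (ha.1 hξ)
  · intro a
    refine ⟨⟨nfp (fun b => max (Order.succ b) (Order.succ (g b))) a.1, ?_⟩, ?_, ?_⟩
    · refine nfp_lt_ord ?_ ?_ a.2
      · rw [cof_omega_two]
        exact aleph0_lt_aleph_one.trans aleph_one_lt_aleph_two
      · intro i hi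
        exact max_lt (isSuccLimit_omega_two.succ_lt hi) (isSuccLimit_omega_two.succ_lt (hg2 i hi))
    · exact fun η hη => lt_nfp_of_lt_nfp hg hη
    · exact le_nfp _ _

end Closure

/-! ### Stationary sets and Ulam's matrix. -/

/-- Given a club, let `g η` be its next element above `η` and `β`. A closure point of `g` of
cofinality `ℵ₁` is a limit of the club, hence in it. -/
theorem isStationary_cofOmegaOne_gt {β : Ordinal.{u}} (hβ : β < ω_ 2) :
    IsStationaryInOmegaTwo {α ∈ cofOmegaOne | β < α} := by
  intro t ht
  have hnext : ∀ η : Ordinal.{u}, η < ω_ 2 → ∃ c : Ordinal.{u}, ∃ h : c < ω_ 2,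
      (⟨c, h⟩ : Set.Iio (ω_ 2 : Ordinal.{u})) ∈ t ∧ η < c ∧ β < c := by
    intro η hη
    obtain ⟨c, hc, hle⟩ := ht.isCofinal ⟨Order.succ (max η β),
      isSuccLimit_omega_two.succ_lt (max_lt hη hβ)⟩
    have : Order.succ (max η β) ≤ c.1 := hle
    rw [Order.succ_le_iff, max_lt_iff] at this
    exact ⟨c.1, c.2, hc, this⟩
  -- Adding `Ici (ω_ 2)` keeps `T η` nonempty for `η ≥ ω₂`, so that `g` is monotone on all ordinals.
  let T : Ordinal.{u} → Set Ordinal.{u} := fun η =>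
    {c | ∃ h : c < ω_ 2, (⟨c, h⟩ : Set.Iio (ω_ 2 : Ordinal.{u})) ∈ t ∧ η < c ∧ β < c} ∪
      Set.Ici (ω_ 2)
  have hTne : ∀ η, (T η).Nonempty := fun η => ⟨ω_ 2, Or.inr Set.self_mem_Ici⟩
  let g : Ordinal.{u} → Ordinal.{u} := fun η => sInf (T η)
  have hgT : ∀ η < ω_ 2, ∃ h : g η < ω_ 2,
      (⟨g η, h⟩ : Set.Iio (ω_ 2 : Ordinal.{u})) ∈ t ∧ η < g η ∧ β < g η := by
    intro η hη
    obtain ⟨c, hc⟩ := hnext η hη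
    have hlt : g η < ω_ 2 := (csInf_le' (show c ∈ T η from Or.inl hc)).trans_lt hc.1
    exact (csInf_mem (hTne η)).resolve_right hlt.not_ge
  have hmono : Monotone g := by
    intro η η' h
    refine csInf_le_csInf' (hTne η') (Set.union_subset_union_left _ ?_)
    rintro c ⟨h1, h2, h3, h4⟩
    exact ⟨h1, h2, h.trans_lt h3, h4⟩
  obtain ⟨ξ, hξ, hcl⟩ := exists_closurePoint hmono fun η hη => (hgT η hη).1
  have hlim := isSuccLimit_of_mem_cofOmegaOne hξ
  have h0 : 0 < ξ := hlim.bot_lt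
  have hβξ : β < ξ := by
    obtain ⟨_, _, _, h⟩ := hgT 0 (h0.trans hξ.1)
    exact h.trans (hcl 0 h0)
  refine ⟨⟨ξ, hξ.1⟩, ⟨hξ, hβξ⟩, ?_⟩
  refine ht.isLUB_mem (t := {c | c ∈ t ∧ c.1 < ξ}) (fun c hc => hc.1) ?_ ⟨?_, ?_⟩
  · obtain ⟨h1, h2, _⟩ := hgT 0 (h0.trans hξ.1)
    exact ⟨⟨g 0, h1⟩, h2, hcl 0 h0⟩
  · exact fun c hc => hc.2.le
  · intro b hb
    refine le_of_forall_lt (α := Ordinal.{u}) (a := ξ) (b := b.1) fun η hη => ?_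
    obtain ⟨h1, h2, h3, _⟩ := hgT η (hη.trans hξ.1)
    exact h3.trans_le (hb (a := ⟨g η, h1⟩) ⟨h2, hcl η hη⟩)

/-- Ulam's theorem for the ordinals below `ω₂` of cofinality `ℵ₁`. -/
theorem exists_isStationaryPartition : ∃ S₀ S₁ : Set Ordinal.{u}, IsStationaryPartition S₀ S₁ := by
  have hinj : ∀ α : Ordinal.{u}, α < ω_ 2 →
      Nonempty (Set.Iio α ↪ Set.Iio (ω_ 1 : Ordinal.{u})) := by
    intro α hα
    rw [← Cardinal.le_def, mk_Iio_omega_one]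
    exact mk_Iio_le_of_lt_omega_two hα
  let f : ∀ α : Set.Iio (ω_ 2 : Ordinal.{u}), Set.Iio α.1 ↪ Set.Iio (ω_ 1 : Ordinal.{u}) :=
    fun α => (hinj α.1 α.2).some
  -- For fixed `β` the `ω₁` many sets `U ξ β` cover the points above `β`, so one is stationary; for
  -- fixed `ξ` they are pairwise disjoint, as each `f α` is injective. Two values of `β` must share
  -- the same `ξ`.
  let U : Set.Iio (ω_ 1 : Ordinal.{u}) → Ordinal.{u} → Set Ordinal.{u} := fun ξ β =>
    {α | α ∈ cofOmegaOne ∧ ∃ (h2 : α < ω_ 2) (h : β < α), f ⟨α, h2⟩ ⟨β, h⟩ = ξ}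
  have hcof : Order.cof (Set.Iio (ω_ 2 : Ordinal.{u})) = ℵ_ 2 := by
    rw [cof_Iio, ← lift_cof, cof_omega_two]; simp
  have hstat : ∀ β : Set.Iio (ω_ 2 : Ordinal.{u}), ∃ ξ, IsStationaryInOmegaTwo (U ξ β.1) := by
    intro β
    have h := isStationary_cofOmegaOne_gt β.2
    refine (isStationary_iUnion_iff ?_ ?_).1 (IsStationary.mono h ?_)
    · rw [hcof]
      exact (aleph0_lt_aleph_one.trans aleph_one_lt_aleph_two).ne'
    · rw [hcof, mk_Iio_omega_one]
      simp
    · rintro ⟨α, h2⟩ ⟨hα, hlt⟩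
      exact Set.mem_iUnion.2 ⟨f ⟨α, h2⟩ ⟨β.1, hlt⟩, hα, h2, hlt, rfl⟩
  choose F hF using hstat
  have hnot : ¬ Function.Injective F := by
    intro h
    have := Cardinal.mk_le_of_injective h
    rw [mk_Iio_omega_one, mk_Iio_omega_two] at this
    exact this.not_gt aleph_one_lt_aleph_two
  simp only [Function.Injective, not_forall] at hnot
  obtain ⟨β, γ, hFe, hne⟩ := hnot
  refine ⟨U (F β) β.1, cofOmegaOne \ U (F β) β.1, Set.disjoint_sdiff_right, ?_, hF β, ?_⟩
  · exact Set.union_sdiff_cancel fun α h => h.1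
  · refine IsStationary.mono (hF γ) ?_
    rintro α ⟨hα, h2, h, he⟩
    refine ⟨hα, ?_⟩
    rintro ⟨_, _, h', he'⟩
    rw [hFe, ← he] at he'
    have := (f ⟨α, h2⟩).injective he'
    exact hne (Subtype.ext (congrArg (fun z : Set.Iio α.1 => z.1) this))

/-! ### Chains of subalgebras generated by initial segments. -/

section Generators

variable {B : Type v} [BooleanAlgebra B] (x : Ordinal.{u} → B)

/-- The subalgebra generated by the first `α` elements of a sequence. -/
def initialClosure (α : Ordinal.{u}) : BooleanSubalgebra B :=
  BooleanSubalgebra.closure (x '' Set.Iio α)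

theorem initialClosure_mono : Monotone (initialClosure x) := fun _ _ h =>
  BooleanSubalgebra.closure_mono (Set.image_mono (Set.Iio_subset_Iio h))

theorem mem_initialClosure {α β : Ordinal.{u}} (h : β < α) : x β ∈ initialClosure x α :=
  BooleanSubalgebra.subset_closure (Set.mem_image_of_mem _ h)

theorem initialClosure_zero : (initialClosure x 0 : Set B) = {⊥, ⊤} := by
  have h : initialClosure x 0 = ⊥ := by
    rw [eq_bot_iff, initialClosure, BooleanSubalgebra.closure_le]
    rintro _ ⟨β, hβ, _⟩
    exact (not_lt_bot (a := β) hβ).elim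
  rw [h, BooleanSubalgebra.coe_bot]

theorem initialClosure_succ (α : Ordinal.{u}) : initialClosure x (Order.succ α) =
    BooleanSubalgebra.closure (insert (x α) (initialClosure x α : Set B)) := by
  apply le_antisymm
  · rw [initialClosure, BooleanSubalgebra.closure_le]
    rintro _ ⟨β, hβ, rfl⟩
    rcases (Order.lt_succ_iff.1 (Set.mem_Iio.1 hβ)).lt_or_eq with h | rfl
    · exact BooleanSubalgebra.subset_closure (Or.inr (mem_initialClosure x h))
    · exact BooleanSubalgebra.subset_closure (Or.inl rfl)
  · rw [BooleanSubalgebra.closure_le]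
    rintro a (rfl | h)
    · exact mem_initialClosure x (Order.lt_succ α)
    · exact initialClosure_mono x (Order.le_succ α) h

theorem exists_mem_initialClosure {α : Ordinal.{u}} (hα : Order.IsSuccLimit α) {a : B}
    (ha : a ∈ initialClosure x α) : ∃ β < α, a ∈ initialClosure x β := by
  induction ha using BooleanSubalgebra.closure_bot_sup_induction with
  | mem a ha =>
    obtain ⟨β, hβ, rfl⟩ := ha
    exact ⟨_, hα.succ_lt hβ, mem_initialClosure x (Order.lt_succ β)⟩
  | bot => exact ⟨0, hα.bot_lt, BooleanSubalgebra.bot_mem⟩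
  | sup a _ b _ h₁ h₂ =>
    obtain ⟨β, hβ, ha⟩ := h₁
    obtain ⟨γ, hγ, hb⟩ := h₂
    exact ⟨max β γ, max_lt hβ hγ, BooleanSubalgebra.sup_mem
      (initialClosure_mono x (le_max_left _ _) ha) (initialClosure_mono x (le_max_right _ _) hb)⟩
  | compl a _ h =>
    obtain ⟨β, hβ, ha⟩ := h
    exact ⟨β, hβ, BooleanSubalgebra.compl_mem ha⟩

end Generators

/-! ### Existence of the algebra as an algebra of sets. -/

/-- The Stone space of `A^S`: the sets of ordinals below `ω₂` that contain `α ∈ S` as soon as they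
contain some point of the ladder at `α`. -/
def ladderSpace (S : Set Ordinal.{u}) (δ : Ordinal.{u} → Ordinal.{u} → Ordinal.{u}) :
    Set (Set Ordinal.{u}) :=
  {p | p ∈ 𝒫 (Set.Iio (ω_ 2)) ∧ ∀ α ∈ S, ∀ β < ω_ 1, δ α β ∈ p → α ∈ p}

section Representation

variable {S : Set Ordinal.{u}} {δ : Ordinal.{u} → Ordinal.{u} → Ordinal.{u}}

instance : Small.{u} (ladderSpace S δ) :=
  small_subset (s := 𝒫 (Set.Iio (ω_ 2))) fun _ h => h.1

/-- The points of the space containing `α`. -/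
def ladderGen (S : Set Ordinal.{u}) (δ : Ordinal.{u} → Ordinal.{u} → Ordinal.{u})
    (α : Ordinal.{u}) : Set (ladderSpace S δ) :=
  {p | α ∈ p.1}

theorem ladderSpace_extend_of_mem (hS : S ⊆ cofOmegaOne) (hδ : IsLadderSystem δ)
    {p : Set Ordinal.{u}} (hp : p ∈ ladderSpace S δ) (α : Ordinal.{u}) :
    p ∩ Set.Iio α ∪ Set.Ici α ∩ Set.Iio (ω_ 2) ∈ ladderSpace S δ := by
  refine ⟨?_, fun γ hγ β hβ h => ?_⟩
  · rintro γ (h | h)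
    · exact hp.1 h.1
    · exact h.2
  · rcases lt_or_ge γ α with hlt | hle
    · rcases h with h | h
      · exact Or.inl ⟨hp.2 γ hγ β hβ h.1, hlt⟩
      · exact ((hδ.lt γ (hS hγ) β hβ).trans hlt).not_ge h.1 |>.elim
    · exact Or.inr ⟨hle, (hS hγ).1⟩

/-- Ladders at `γ` lie below `γ`, so what is added above `α` never forces `α` or anything below it;
only the ladder at `α` itself could force `α`. -/
theorem ladderSpace_extend_of_notMem (hS : S ⊆ cofOmegaOne) (hδ : IsLadderSystem δ)
    {p : Set Ordinal.{u}} (hp : p ∈ ladderSpace S δ) {α : Ordinal.{u}}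
    (hα : α ∈ S → ∀ β < ω_ 1, δ α β ∉ p) :
    p ∩ Set.Iio α ∪ Set.Ioi α ∩ Set.Iio (ω_ 2) ∈ ladderSpace S δ := by
  refine ⟨?_, fun γ hγ β hβ h => ?_⟩
  · rintro γ (h | h)
    · exact hp.1 h.1
    · exact h.2
  · rcases lt_trichotomy γ α with hlt | rfl | hlt
    · rcases h with h | h
      · exact Or.inl ⟨hp.2 γ hγ β hβ h.1, hlt⟩
      · exact ((hδ.lt γ (hS hγ) β hβ).trans hlt).not_gt h.1 |>.elim
    · rcases h with h | h
      · exact (hα hγ β hβ h.1).elim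
      · exact ((hδ.lt γ (hS hγ) β hβ)).not_gt h.1 |>.elim
    · exact Or.inr ⟨hlt, (hS hγ).1⟩

/-- Ladder points are successors, while `S` consists of limits. Hence every generator on a ladder is
independent over the earlier stages. -/
theorem ladder_notMem (hS : S ⊆ cofOmegaOne) (hδ : IsLadderSystem δ) {α β : Ordinal.{u}}
    (hα : α ∈ cofOmegaOne) (hβ : β < ω_ 1) : δ α β ∉ S := by
  intro h
  obtain ⟨γ, hγ⟩ := hδ.succ α hα β hβ
  have hlim := isSuccLimit_of_mem_cofOmegaOne (hS h)
  rw [hγ] at hlim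
  exact Order.not_isSuccLimit_succ γ hlim

theorem ladderSpace_diff (hS : S ⊆ cofOmegaOne) (hδ : IsLadderSystem δ)
    {p : Set Ordinal.{u}} (hp : p ∈ ladderSpace S δ) {α : Ordinal.{u}} (hα : α ∈ S) :
    p \ (δ α '' Set.Iio (ω_ 1)) ∈ ladderSpace S δ := by
  refine ⟨fun γ h => hp.1 h.1, fun γ hγ β hβ h => ⟨hp.2 γ hγ β hβ h.1, ?_⟩⟩
  rintro ⟨β', hβ', rfl⟩
  exact ladder_notMem hS hδ (hS hα) hβ' hγ

variable {B : Type v} [BooleanAlgebra B] (e : BoundedLatticeHom B (Set (ladderSpace S δ)))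
  {x : Ordinal.{u} → B}

/-- An element of the algebra depends on finitely many coordinates only. -/
theorem exists_finset_support (hx : ∀ α < ω_ 2, e (x α) = ladderGen S δ α) {α : Ordinal.{u}}
    (hα : α ≤ ω_ 2) {a : B} (ha : a ∈ initialClosure x α) :
    ∃ F : Finset Ordinal.{u}, (∀ γ ∈ F, γ < α) ∧ ∀ p q : ladderSpace S δ,
      (∀ γ ∈ F, γ ∈ p.1 ↔ γ ∈ q.1) → (p ∈ e a ↔ q ∈ e a) := by
  classical
  induction ha using BooleanSubalgebra.closure_bot_sup_induction with
  | mem a ha =>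
    obtain ⟨β, hβ, rfl⟩ := ha
    refine ⟨{β}, by simpa using hβ, fun p q h => ?_⟩
    rw [hx β (lt_of_lt_of_le hβ hα)]
    exact h β (Finset.mem_singleton_self β)
  | bot => exact ⟨∅, by simp, fun p q _ => by simp⟩
  | sup a _ b _ h₁ h₂ =>
    obtain ⟨F, hF, hF'⟩ := h₁
    obtain ⟨G, hG, hG'⟩ := h₂
    refine ⟨F ∪ G, fun γ hγ => ?_, fun p q h => ?_⟩
    · rcases Finset.mem_union.1 hγ with h | h
      exacts [hF γ h, hG γ h]
    · rw [map_sup]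
      exact or_congr (hF' p q fun γ hγ => h γ (Finset.mem_union_left _ hγ))
        (hG' p q fun γ hγ => h γ (Finset.mem_union_right _ hγ))
  | compl a _ h =>
    obtain ⟨F, hF, hF'⟩ := h
    refine ⟨F, hF, fun p q h => ?_⟩
    rw [map_compl']
    exact not_congr (hF' p q h)

theorem mem_congr_of_inter_eq (hx : ∀ α < ω_ 2, e (x α) = ladderGen S δ α) {α : Ordinal.{u}}
    (hα : α ≤ ω_ 2) {a : B} (ha : a ∈ initialClosure x α) {p q : ladderSpace S δ}
    (h : ∀ γ < α, γ ∈ p.1 ↔ γ ∈ q.1) : p ∈ e a ↔ q ∈ e a := by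
  obtain ⟨F, hF, hF'⟩ := exists_finset_support e hx hα ha
  exact hF' p q fun γ hγ => h γ (hF γ hγ)

/-- Membership of a point in an element of stage `α` depends only on coordinates below `α`, so the
point can be changed from `α` on. Putting `α` in is always possible; leaving it out is possible
unless `α ∈ S` and the point meets the ladder at `α`. This yields every clause about `x α`. -/
theorem isConstruction_initialClosure (hS : S ⊆ cofOmegaOne) (hδ : IsLadderSystem δ)
    (he : Function.Injective e) (hx : ∀ α < ω_ 2, e (x α) = ladderGen S δ α)
    (hrange : ∀ b, e b ∈ BooleanSubalgebra.closure (ladderGen S δ '' Set.Iio (ω_ 2))) :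
    IsConstruction S δ (initialClosure x) x := by
  classical
  have hle : ∀ a b : B, a ≤ b ↔ e a ⊆ e b := fun a b => by
    rw [← inf_eq_left, ← he.eq_iff, map_inf]
    exact inf_eq_left
  have hbot : ∀ a : B, a ≠ ⊥ ↔ ∃ p, p ∈ e a := fun a => by
    rw [← Set.nonempty_def, Set.nonempty_iff_ne_empty, ne_eq, ← he.eq_iff, map_bot]
    rfl
  have hempty : (∅ : Set Ordinal.{u}) ∈ ladderSpace S δ :=
    ⟨Set.empty_subset _, fun _ _ _ _ h => h.elim⟩
  let up : ladderSpace S δ → Ordinal.{u} → ladderSpace S δ := fun p α =>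
    ⟨_, ladderSpace_extend_of_mem hS hδ p.2 α⟩
  have hup : ∀ p α, α < ω_ 2 → ∀ a ∈ initialClosure x α, (up p α ∈ e a ↔ p ∈ e a) := by
    refine fun p α hα a ha => mem_congr_of_inter_eq e hx hα.le ha fun γ hγ => ?_
    exact ⟨fun h => h.elim (fun h => h.1) fun h => (hγ.not_ge h.1).elim, fun h => Or.inl ⟨h, hγ⟩⟩
  have hupmem : ∀ p α, α < ω_ 2 → up p α ∈ e (x α) := fun p α hα => by
    rw [hx α hα]; exact Or.inr ⟨Set.self_mem_Ici, hα⟩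
  have hdown : ∀ (p : ladderSpace S δ) (α), α < ω_ 2 → (α ∈ S → ∀ β < ω_ 1, δ α β ∉ p.1) →
      ∃ q : ladderSpace S δ, (∀ a ∈ initialClosure x α, q ∈ e a ↔ p ∈ e a) ∧ q ∉ e (x α) := by
    refine fun p α hα h => ⟨⟨_, ladderSpace_extend_of_notMem hS hδ p.2 h⟩, fun a ha => ?_, ?_⟩
    · refine mem_congr_of_inter_eq e hx hα.le ha fun γ hγ => ?_
      exact ⟨fun h => h.elim (fun h => h.1) fun h => (hγ.not_gt h.1).elim,
        fun h => Or.inl ⟨h, hγ⟩⟩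
    · rw [hx α hα]
      rintro (h | h)
      · exact lt_irrefl α h.2
      · exact lt_irrefl α h.1
  have hgen : ∀ α ∈ S, ∀ β < ω_ 1, x (δ α β) ≤ x α := fun α hα β hβ => by
    have h2 := (hS hα).1
    rw [hle, hx α h2, hx _ ((hδ.lt α (hS hα) β hβ).trans h2)]
    exact fun p hp => p.2.2 α hα β hβ hp
  refine ⟨?_, initialClosure_zero x, ?_, fun α _ => initialClosure_succ x α, ?_, ?_, ?_, ?_, ?_⟩
  · rw [ne_comm, hbot, map_top]
    exact ⟨⟨∅, hempty⟩, trivial⟩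
  · intro α _ hα
    ext a
    simp only [Set.mem_iUnion, SetLike.mem_coe, Set.mem_Iio, exists_prop]
    refine ⟨exists_mem_initialClosure x hα, ?_⟩
    rintro ⟨β, hβ, h⟩
    exact initialClosure_mono x hβ.le h
  · intro α hα hαS a ha hne
    obtain ⟨p, hp⟩ := (hbot a).1 hne
    constructor
    · rw [hbot, map_inf]
      exact ⟨up p α, (hup p α hα a ha).2 hp, hupmem p α hα⟩
    · obtain ⟨q, hq, hq'⟩ := hdown p α hα fun h => (hαS h).elim
      rw [hbot, map_inf, map_compl']
      exact ⟨q, (hq a ha).2 hp, hq'⟩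
  · intro α hα hαS h
    obtain ⟨q, hq, hq'⟩ := hdown ⟨∅, hempty⟩ α hα fun _ β _ h => h
    exact hq' ((hq _ h).2 ((hup _ α hα _ h).1 (hupmem _ α hα)))
  · intro α hα hαS a ha
    constructor
    · intro hax
      obtain ⟨F, hF, hF'⟩ := exists_finset_support e hx hα.le ha
      have hinv : ∀ γ : Ordinal.{u}, ∃ β < ω_ 1, γ ∈ δ α '' Set.Iio (ω_ 1) → δ α β = γ := by
        intro γ
        by_cases h : γ ∈ δ α '' Set.Iio (ω_ 1)
        · obtain ⟨β, hβ, hβ'⟩ := h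
          exact ⟨β, hβ, fun _ => hβ'⟩
        · exact ⟨0, omega_pos 1, fun h' => (h h').elim⟩
      choose inv hinv1 hinv2 using hinv
      refine ⟨F.image inv, ?_, ?_⟩
      · intro β hβ
        obtain ⟨γ, _, rfl⟩ := Finset.mem_image.1 hβ
        exact hinv1 γ
      · rw [hle]
        intro p hp
        by_contra hnot
        have hfree : ∀ γ ∈ F, γ ∈ δ α '' Set.Iio (ω_ 1) → γ ∉ p.1 := by
          intro γ hγ hγδ hγp
          refine hnot (((hle _ _).1 (Finset.le_sup (f := fun β => x (δ α β))
            (Finset.mem_image_of_mem inv hγ))) ?_)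
          rw [hinv2 γ hγδ, hx γ ((hF γ hγ).trans hα)]
          exact hγp
        -- If `p ∈ e a` avoids the ladder points in the support of `a`, deleting the whole ladder
        -- does not affect membership in `e a`. Then `α` can be left out, contradicting `a ≤ x α`.
        let q : ladderSpace S δ := ⟨_, ladderSpace_diff hS hδ p.2 hαS⟩
        have hqa : q ∈ e a := by
          refine (hF' q p fun γ hγ => ⟨fun h => h.1, fun h => ⟨h, fun hγδ => ?_⟩⟩).2 hp
          exact hfree γ hγ hγδ h
        obtain ⟨r, hr, hr'⟩ := hdown q α hα fun _ β hβ h => h.2 ⟨β, hβ, rfl⟩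
        exact hr' ((hle _ _).1 hax ((hr a ha).2 hqa))
    · rintro ⟨t, ht, hat⟩
      exact hat.trans (Finset.sup_le fun β hβ => hgen α hαS β (ht β hβ))
  · intro α hα _ a ha hax
    by_contra hne
    obtain ⟨p, hp⟩ := (hbot a).1 hne
    have := (hle _ _).1 hax ((hup p α hα a ha).2 hp)
    rw [map_compl'] at this
    exact this (hupmem p α hα)
  · intro b
    have hb : e b ∈ (initialClosure x (ω_ 2)).map e := by
      refine (BooleanSubalgebra.closure_le.2 ?_) (hrange b)
      rintro _ ⟨α, hα, rfl⟩
      exact ⟨x α, mem_initialClosure x hα, hx α hα⟩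
    obtain ⟨c, hc, hcb⟩ := hb
    rw [he hcb] at hc
    exact exists_mem_initialClosure x isSuccLimit_omega_two hc

theorem exists_isLadderAlgebra (hS : S ⊆ cofOmegaOne) (hδ : IsLadderSystem δ) :
    ∃ A : SetBooleanAlgebra.{u}, IsLadderAlgebra S δ A.carrier := by
  let C : BooleanSubalgebra (Set (ladderSpace S δ)) :=
    BooleanSubalgebra.closure (ladderGen S δ '' Set.Iio (ω_ 2))
  -- Elements are coded by von Neumann ordinals through a well-ordering, which moves the algebra
  -- onto a set of `ZFSet`.
  let r : Shrink.{u} C → Shrink.{u} C → Prop := WellOrderingRel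
  let i : C → ZFSet.{u} := fun c => (typein r (equivShrink C c)).toZFSet
  have hi : Function.Injective i := fun a b h =>
    (equivShrink C).injective (typein_injective r (toZFSet_injective h))
  let E : ZFSet.range i ≃ C :=
    (Equiv.setCongr (ZFSet.coe_range i)).trans (Equiv.ofInjective i hi).symm
  let : BooleanAlgebra (ZFSet.range i) := E.booleanAlgebra
  let e : BoundedLatticeHom (ZFSet.range i) (Set (ladderSpace S δ)) :=
    { toFun := fun a => (E a).1
      map_sup' := fun a b => by
        rw [show a ⊔ b = E.symm (E a ⊔ E b) from rfl, E.apply_symm_apply]; rfl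
      map_inf' := fun a b => by
        rw [show a ⊓ b = E.symm (E a ⊓ E b) from rfl, E.apply_symm_apply]; rfl
      map_top' := by
        rw [show (⊤ : ZFSet.range i) = E.symm ⊤ from rfl, E.apply_symm_apply]; rfl
      map_bot' := by
        rw [show (⊥ : ZFSet.range i) = E.symm ⊥ from rfl, E.apply_symm_apply]; rfl }
  have he : Function.Injective e := fun a b h => E.injective (Subtype.ext h)
  have hgen : ∀ α : Ordinal.{u}, ∃ a, α < ω_ 2 → e a = ladderGen S δ α := by
    intro α
    by_cases h : α < ω_ 2
    · refine ⟨E.symm ⟨ladderGen S δ α, BooleanSubalgebra.subset_closure ⟨α, h, rfl⟩⟩, fun _ => ?_⟩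
      exact congrArg Subtype.val (E.apply_symm_apply _)
    · exact ⟨⊥, fun h' => (h h').elim⟩
  choose x hx using hgen
  exact ⟨⟨ZFSet.range i⟩, initialClosure x, x,
    isConstruction_initialClosure e hS hδ he hx fun b => (E b).2⟩

end Representation

/-! ### How the stages `A α` embed in the whole algebra. -/

theorem inf_le_inf_sup_inf_compl {B : Type*} [BooleanAlgebra B] (u v x : B) :
    u ⊓ v ≤ u ⊓ x ⊔ v ⊓ xᶜ :=
  calc u ⊓ v = u ⊓ v ⊓ x ⊔ u ⊓ v ⊓ xᶜ := by rw [← inf_sup_left, sup_compl_eq_top, inf_top_eq]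
    _ ≤ _ := sup_le_sup (inf_le_inf_right _ inf_le_left) (inf_le_inf_right _ inf_le_right)

theorem exists_uncountable_fiber {B ι : Type*} [Countable ι] {T : Set B} (hT : ¬ T.Countable)
    (f : B → ι) : ∃ i, ¬ {c | c ∈ T ∧ f c = i}.Countable := by
  by_contra! h
  refine hT ((Set.countable_iUnion h).mono fun c hc => ?_)
  exact Set.mem_iUnion.2 ⟨f c, hc, rfl⟩

theorem mk_iUnion_le_aleph_one {B : Type u} {ι : Type v} (hι : #ι ≤ ℵ₁) {f : ι → Set B}
    (hf : ∀ i, #(f i) ≤ ℵ₁) : #(⋃ i, f i) ≤ ℵ₁ := by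
  rw [← Cardinal.lift_le.{v}]
  refine (Cardinal.mk_iUnion_le_lift f).trans ?_
  rw [Cardinal.lift_aleph, Ordinal.lift_one]
  have h1 : Cardinal.lift.{u} #ι ≤ ℵ₁ := by simpa using Cardinal.lift_le.{u}.2 hι
  have h2 : ⨆ i, Cardinal.lift.{v} #(f i) ≤ ℵ₁ :=
    ciSup_le' fun i => by simpa using Cardinal.lift_le.{v}.2 (hf i)
  exact (mul_le_mul' h1 h2).trans (Cardinal.mul_eq_self aleph0_lt_aleph_one.le).le

namespace IsConstruction

variable {S : Set Ordinal.{u}} {δ : Ordinal.{u} → Ordinal.{u} → Ordinal.{u}} {B : Type v}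
  [BooleanAlgebra B] {A : Ordinal.{u} → BooleanSubalgebra B} {x : Ordinal.{u} → B}

theorem le_succ (h : IsConstruction S δ A x) {α : Ordinal.{u}} (hα : α < ω_ 2) :
    A α ≤ A (Order.succ α) := by
  rw [h.succ α hα]
  exact fun a ha => BooleanSubalgebra.subset_closure (Or.inr ha)

theorem gen_mem_succ (h : IsConstruction S δ A x) {α : Ordinal.{u}} (hα : α < ω_ 2) :
    x α ∈ A (Order.succ α) := by
  rw [h.succ α hα]
  exact BooleanSubalgebra.subset_closure (Or.inl rfl)

theorem mem_limit_iff (h : IsConstruction S δ A x) {α : Ordinal.{u}} (hα : α < ω_ 2)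
    (hlim : Order.IsSuccLimit α) {a : B} : a ∈ A α ↔ ∃ β < α, a ∈ A β := by
  rw [← SetLike.mem_coe, h.limit α hα hlim]
  simp

theorem mono (h : IsConstruction S δ A x) {α β : Ordinal.{u}} (hαβ : α ≤ β) (hβ : β < ω_ 2) :
    A α ≤ A β := by
  induction β using Ordinal.limitRecOn with
  | zero => rw [nonpos_iff_eq_zero.1 hαβ]
  | add_one β ih =>
    rw [← Order.succ_eq_add_one] at hαβ hβ ⊢
    have hβ' := (Order.lt_succ β).trans hβ
    rcases hαβ.lt_or_eq with hlt | rfl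
    · exact (ih (Order.lt_succ_iff.1 hlt) hβ').trans (h.le_succ hβ')
    · exact le_rfl
  | limit β hlim ih =>
    rcases hαβ.lt_or_eq with hlt | rfl
    · exact fun a ha => (h.mem_limit_iff hβ hlim).2 ⟨α, hlt, ha⟩
    · exact le_rfl

theorem gen_mem (h : IsConstruction S δ A x) {α β : Ordinal.{u}} (hαβ : α < β) (hβ : β < ω_ 2) :
    x α ∈ A β :=
  h.mono (Order.succ_le_of_lt hαβ) hβ (h.gen_mem_succ (hαβ.trans hβ))

theorem sup_gen_mem (h : IsConstruction S δ A x) {ι : Type*} {t : Finset ι} {f : ι → Ordinal.{u}}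
    {β : Ordinal.{u}} (hβ : β < ω_ 2) (ht : ∀ i ∈ t, f i < β) : (t.sup fun i => x (f i)) ∈ A β :=
  Finset.sup_induction BooleanSubalgebra.bot_mem (fun _ ha _ hb => BooleanSubalgebra.sup_mem ha hb)
    fun i hi => h.gen_mem (ht i hi) hβ

/-- Elements of the simple extension `A (α + 1)` in terms of elements of `A α`. -/
theorem exists_eq_of_mem_succ (h : IsConstruction S δ A x) {α : Ordinal.{u}} (hα : α < ω_ 2)
    {b : B} (hb : b ∈ A (Order.succ α)) :
    ∃ u ∈ A α, ∃ v ∈ A α, b = u ⊓ x α ⊔ v ⊓ (x α)ᶜ := by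
  rw [h.succ α hα] at hb
  induction hb using BooleanSubalgebra.closure_bot_sup_induction with
  | mem b hb =>
    rcases hb with rfl | hb
    · exact ⟨⊤, BooleanSubalgebra.top_mem, ⊥, BooleanSubalgebra.bot_mem, by simp⟩
    · exact ⟨b, hb, b, hb, by rw [← inf_sup_left, sup_compl_eq_top, inf_top_eq]⟩
  | bot => exact ⟨⊥, BooleanSubalgebra.bot_mem, ⊥, BooleanSubalgebra.bot_mem, by simp⟩
  | sup a _ b _ h₁ h₂ =>
    obtain ⟨u, hu, v, hv, rfl⟩ := h₁
    obtain ⟨u', hu', v', hv', rfl⟩ := h₂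
    refine ⟨u ⊔ u', BooleanSubalgebra.sup_mem hu hu', v ⊔ v', BooleanSubalgebra.sup_mem hv hv', ?_⟩
    rw [inf_sup_right, inf_sup_right]
    exact sup_sup_sup_comm _ _ _ _
  | compl a _ h =>
    obtain ⟨u, hu, v, hv, rfl⟩ := h
    refine ⟨uᶜ, BooleanSubalgebra.compl_mem hu, vᶜ, BooleanSubalgebra.compl_mem hv, ?_⟩
    refine IsCompl.compl_eq ⟨?_, ?_⟩
    · rw [disjoint_iff]
      simp only [inf_sup_left, inf_sup_right]
      have h1 : u ⊓ x α ⊓ (uᶜ ⊓ x α) = ⊥ := by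
        rw [inf_inf_inf_comm, inf_compl_eq_bot, bot_inf_eq]
      have h2 : u ⊓ x α ⊓ (vᶜ ⊓ (x α)ᶜ) = ⊥ := by
        rw [inf_inf_inf_comm, inf_compl_eq_bot, inf_bot_eq]
      have h3 : v ⊓ (x α)ᶜ ⊓ (uᶜ ⊓ x α) = ⊥ := by
        rw [inf_inf_inf_comm, compl_inf_eq_bot, inf_bot_eq]
      have h4 : v ⊓ (x α)ᶜ ⊓ (vᶜ ⊓ (x α)ᶜ) = ⊥ := by
        rw [inf_inf_inf_comm, inf_compl_eq_bot, bot_inf_eq]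
      simp [h1, h2, h3, h4]
    · rw [codisjoint_iff, sup_sup_sup_comm, ← inf_sup_right, ← inf_sup_right, sup_compl_eq_top,
        sup_compl_eq_top, top_inf_eq, top_inf_eq, sup_compl_eq_top]

theorem le_of_inf_gen_le (h : IsConstruction S δ A x) {α : Ordinal.{u}} (hα : α < ω_ 2)
    (hαS : α ∉ S) {a b : B} (ha : a ∈ A α) (hb : b ∈ A α) (hle : a ⊓ x α ≤ b) : a ≤ b := by
  rw [← sdiff_eq_bot_iff]
  by_contra hne
  refine (h.independent α hα hαS _ (BooleanSubalgebra.sdiff_mem ha hb) hne).1 ?_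
  rwa [sdiff_eq, inf_right_comm, ← sdiff_eq, sdiff_eq_bot_iff]

theorem le_of_inf_compl_gen_le (h : IsConstruction S δ A x) {α : Ordinal.{u}} (hα : α < ω_ 2)
    (hαS : α ∉ S) {a b : B} (ha : a ∈ A α) (hb : b ∈ A α) (hle : a ⊓ (x α)ᶜ ≤ b) : a ≤ b := by
  rw [← sdiff_eq_bot_iff]
  by_contra hne
  refine (h.independent α hα hαS _ (BooleanSubalgebra.sdiff_mem ha hb) hne).2 ?_
  rwa [sdiff_eq, inf_right_comm, ← sdiff_eq, sdiff_eq_bot_iff]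

/-- Joins of finitely many independent generators that come after `ξ` bound no element of `A ξ`
but `⊥`. -/
theorem eq_bot_of_le_sup (h : IsConstruction S δ A x) {ξ : Ordinal.{u}} {a : B} (ha : a ∈ A ξ)
    (t : Finset Ordinal.{u}) (ht : ∀ γ ∈ t, ξ ≤ γ ∧ γ < ω_ 2 ∧ γ ∉ S) (hle : a ≤ t.sup x) :
    a = ⊥ := by
  induction t using Finset.induction_on_max with
  | empty => simpa using hle
  | insert γ t hmax ih =>
    obtain ⟨h1, h2, h3⟩ := ht γ (Finset.mem_insert_self γ t)
    refine ih (fun β hβ => ht β (Finset.mem_insert_of_mem hβ)) ?_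
    refine h.le_of_inf_compl_gen_le h2 h3 (h.mono h1 h2 ha) (h.sup_gen_mem (f := id) h2 hmax) ?_
    rw [Finset.sup_insert] at hle
    rw [← sdiff_eq, sdiff_le_iff]
    exact hle

/-- At `α ∈ S` the ideal `A α ↾ x α` is not countably generated. -/
theorem not_sigmaEmbedded (h : IsConstruction S δ A x) (hS : S ⊆ cofOmegaOne)
    (hδ : IsLadderSystem δ) {α : Ordinal.{u}} (hα : α ∈ S) :
    ¬ SigmaEmbedded (A α) := by
  intro hsig
  have hE := hS hα
  obtain ⟨C, hC, hCsub, hcof⟩ := hsig (x α)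
  have hfin : ∀ c : B, ∃ t : Finset Ordinal.{u}, c ∈ C → (∀ β ∈ t, β < ω_ 1) ∧
      c ≤ t.sup fun β => x (δ α β) := by
    intro c
    by_cases hc : c ∈ C
    · obtain ⟨t, ht⟩ := (h.below α hE.1 hα c (hCsub hc).1).1 (hCsub hc).2
      exact ⟨t, fun _ => ht⟩
    · exact ⟨∅, fun h' => (hc h').elim⟩
  choose t ht using hfin
  -- Countably many finite sets of indices are bounded below `ω₁`, so one ladder generator comes
  -- after all those used by `C`.
  obtain ⟨ξ, hξ, hbound⟩ := exists_bound_of_countable cof_omega_one.{u}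
    (hC.biUnion fun c _ => (t c).countable_toSet) (by
      intro β hβ
      obtain ⟨c, hc, hβ⟩ := Set.mem_iUnion₂.1 hβ
      exact (ht c hc).1 β hβ)
  have hlt : ∀ β < ω_ 1, δ α β < ω_ 2 := fun β hβ => (hδ.lt α hE β hβ).trans hE.1
  have hmem : x (δ α ξ) ∈ A α := h.gen_mem (hδ.lt α hE ξ hξ) hE.1
  obtain ⟨c, hc, hle⟩ := hcof _ hmem ((h.below α hE.1 hα _ hmem).2
    ⟨{ξ}, by simpa using hξ, by simp⟩)
  have hle' := hle.trans (ht c hc).2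
  have htc : ∀ β ∈ t c, β < ξ := fun β hβ => hbound β (Set.mem_iUnion₂.2 ⟨c, hc, hβ⟩)
  have hsup : ((t c).sup fun β => x (δ α β)) ∈ A (δ α ξ) :=
    h.sup_gen_mem (hlt ξ hξ) fun β hβ =>
      hδ.strictMono α hE ((ht c hc).1 β hβ) hξ (htc β hβ)
  -- The generator at `δ α ξ` is independent over a stage containing the finite join, so lying below
  -- it forces the join to be `⊤`. Independence over stage `0` excludes that.
  have htop : (⊤ : B) ≤ (t c).sup fun β => x (δ α β) :=
    h.le_of_inf_gen_le (hlt ξ hξ) (ladder_notMem hS hδ hE hξ) BooleanSubalgebra.top_mem hsup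
      (by rwa [top_inf_eq])
  classical
  refine h.bot_ne_top (h.eq_bot_of_le_sup (ξ := 0) BooleanSubalgebra.top_mem
    ((t c).image (δ α)) ?_ (by rwa [Finset.sup_image])).symm
  intro γ hγ
  obtain ⟨β, hβ, rfl⟩ := Finset.mem_image.1 hγ
  have hβ' := (ht c hc).1 β hβ
  exact ⟨zero_le, hlt β hβ', ladder_notMem hS hδ hE hβ'⟩

/-- The instance at `b` of `A ≤_sep B`. -/
def SepAt (N : BooleanSubalgebra B) (b : B) : Prop :=
  ∀ T : Set B, T ⊆ {a | a ∈ N ∧ a ≤ b} → ¬ T.Countable →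
    ∃ a, a ∈ N ∧ a ≤ b ∧ ¬ {c | c ∈ T ∧ c ≤ a}.Countable

theorem SepAt.of_mem {N : BooleanSubalgebra B} {b : B} (hb : b ∈ N) : SepAt N b :=
  fun _ hT hunc => by
    refine ⟨b, hb, le_rfl, fun h => hunc (h.mono fun c hc => ?_)⟩
    exact ⟨hc, (hT hc).2⟩

/-- By induction on the stage of `b = u ⊓ x β ⊔ v ⊓ (x β)ᶜ`, the element `b` is replaced by a
smaller one of stage `β` that still bounds uncountably many members of `T`. For `β ∉ S` it is `u ⊓
v`; for `β ∈ S` it is `u ⊓ (v ⊔ s)` with `s` a finite join of ladder generators. -/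
theorem sepAt_of_mem (h : IsConstruction S δ A x) (hS : S ⊆ cofOmegaOne)
    (hδ : IsLadderSystem δ) {α : Ordinal.{u}} (hα : α < ω_ 2) (hαS : α ∉ S)
    {β : Ordinal.{u}} (hβ : β < ω_ 2) {b : B} (hb : b ∈ A β) : SepAt (A α) b := by
  induction β using Ordinal.limitRecOn generalizing b with
  | zero => exact SepAt.of_mem (h.mono (zero_le) hα hb)
  | add_one β ih =>
    rw [← Order.succ_eq_add_one] at hβ hb
    rcases le_or_gt (Order.succ β) α with hle | hlt
    · exact SepAt.of_mem (h.mono hle hα hb)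
    rw [Order.lt_succ_iff] at hlt
    have hβ' := (Order.lt_succ β).trans hβ
    replace ih := fun b hb => ih hβ' (b := b) hb
    obtain ⟨u, hu, v, hv, rfl⟩ := h.exists_eq_of_mem_succ hβ' hb
    intro T hT hunc
    by_cases hβS : β ∈ S
    · have hE := hS hβS
      have hlim := isSuccLimit_of_mem_cofOmegaOne hE
      -- This is where `α ∉ S` is needed: it leaves room for a ladder point between `α` and `β`.
      have hαβ : α < β := lt_of_le_of_ne hlt fun he => hαS (he ▸ hβS)
      have hTu : ∀ c ∈ T, c ≤ u := by
        intro c hc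
        rw [← sdiff_eq_bot_iff]
        refine h.below_compl β hβ' hβS _
          (BooleanSubalgebra.sdiff_mem (h.mono hlt hβ' (hT hc).1) hu) ?_
        rw [sdiff_le_iff]
        exact (hT hc).2.trans (sup_le_sup inf_le_left inf_le_right)
      obtain ⟨η, hη, hvη⟩ := (h.mem_limit_iff hβ' hlim).1 hv
      obtain ⟨ρ, hρ, hρmax⟩ := hδ.cofinal β hE (max α η) (max_lt hαβ hη)
      obtain ⟨hαξ, hηξ⟩ := max_le_iff.1 hρmax
      have hξ : δ β ρ < β := hδ.lt β hE ρ hρ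
      -- Each `c \ v` lies in stage `δ β ρ`, and generators with index at least `ρ` are independent
      -- over that stage, so they can be dropped from the finite join. The remaining indices come
      -- from the countable set `Iio ρ`.
      have hfin : ∀ c : B, ∃ t : Finset (Set.Iio ρ), c ∈ T →
          c \ v ≤ t.sup fun γ => x (δ β γ) := by
        intro c
        by_cases hc : c ∈ T
        swap
        · exact ⟨∅, fun h' => (hc h').elim⟩
        have hcξ : c \ v ∈ A (δ β ρ) := BooleanSubalgebra.sdiff_mem
          (h.mono hαξ (hξ.trans hβ') (hT hc).1) (h.mono hηξ (hξ.trans hβ') hvη)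
        have hcx : c \ v ≤ x β := by
          rw [sdiff_le_iff, sup_comm]
          exact (hT hc).2.trans (sup_le_sup inf_le_right inf_le_left)
        obtain ⟨t, ht, hct⟩ := (h.below β hβ' hβS _ (h.mono hξ.le hβ' hcξ)).1 hcx
        classical
        have hsub : ((t.subtype (· < ρ)).sup fun γ => x (δ β γ.1)) =
            (t.filter (· < ρ)).sup fun γ => x (δ β γ) := by
          rw [← Finset.subtype_map, Finset.sup_map]; rfl
        refine ⟨t.subtype (· < ρ), fun _ => hsub ▸ ?_⟩
        have hmem : ((t.filter (· < ρ)).sup fun γ => x (δ β γ)) ∈ A (δ β ρ) := by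
          refine h.sup_gen_mem (hξ.trans hβ') fun γ hγ => ?_
          obtain ⟨hγt, hγ⟩ := Finset.mem_filter.1 hγ
          exact hδ.strictMono β hE (ht γ hγt) hρ hγ
        rw [← sdiff_eq_bot_iff]
        refine h.eq_bot_of_le_sup (BooleanSubalgebra.sdiff_mem hcξ hmem)
          ((t.filter (¬ · < ρ)).image (δ β)) ?_ ?_
        · intro γ hγ
          obtain ⟨γ, hγf, rfl⟩ := Finset.mem_image.1 hγ
          obtain ⟨hγt, hγ⟩ := Finset.mem_filter.1 hγf
          have hγ1 := ht γ hγt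
          exact ⟨(hδ.strictMono β hE).monotoneOn hρ hγ1 (not_lt.1 hγ),
            (hδ.lt β hE γ hγ1).trans hβ', ladder_notMem hS hδ hE hγ1⟩
        · rw [Finset.sup_image, sdiff_le_iff]
          change _ ≤ _ ⊔ (t.filter (¬ · < ρ)).sup fun γ => x (δ β γ)
          rwa [← Finset.sup_union, Finset.filter_union_filter_not_eq]
      choose t ht using hfin
      have : Countable (Set.Iio ρ) := by
        rw [← Cardinal.mk_le_aleph0_iff, Cardinal.mk_Iio_ordinal]
        have : ρ.card < ℵ₁ := by rwa [← lt_ord, ord_aleph]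
        rw [← Cardinal.succ_aleph0, Order.lt_succ_iff] at this
        exact Cardinal.lift_le_aleph0.2 this
      -- A countable set has only countably many finite subsets, so uncountably many `c` use the
      -- same one.
      obtain ⟨s, hs⟩ := exists_uncountable_fiber hunc t
      have hsup : (s.sup fun γ => x (δ β γ)) ≤ x β := by
        refine Finset.sup_le fun γ _ => ?_
        have hγ1 : γ.1 < ω_ 1 := lt_trans γ.2 hρ
        exact (h.below β hβ' hβS _ (h.gen_mem (hδ.lt β hE _ hγ1) hβ')).2
          ⟨{γ.1}, by simpa using hγ1, by simp⟩
      have hsupmem : (s.sup fun γ => x (δ β γ)) ∈ A β :=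
        h.sup_gen_mem hβ' fun γ _ => hδ.lt β hE _ (lt_trans γ.2 hρ)
      obtain ⟨a, ha, hle, ha'⟩ := ih _ (BooleanSubalgebra.inf_mem hu
        (BooleanSubalgebra.sup_mem hv hsupmem)) {c | c ∈ T ∧ t c = s} (fun c hc =>
          ⟨(hT hc.1).1, le_inf (hTu c hc.1) (sdiff_le_iff.1 (hc.2 ▸ ht c hc.1))⟩) hs
      refine ⟨a, ha, hle.trans ?_, fun hcount => ha' (hcount.mono fun c hc => ?_)⟩
      swap
      · exact ⟨hc.1.1, hc.2⟩
      rw [inf_sup_left]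
      refine sup_le ?_ (le_sup_of_le_left (inf_le_inf_left _ hsup))
      exact inf_le_inf_sup_inf_compl u v (x β)
    · have hwT : ∀ c ∈ T, c ≤ u ⊓ v := by
        intro c hc
        have hcβ := h.mono hlt hβ' (hT hc).1
        refine le_inf (h.le_of_inf_gen_le hβ' hβS hcβ hu ?_)
          (h.le_of_inf_compl_gen_le hβ' hβS hcβ hv ?_)
        · refine (inf_le_inf_right _ (hT hc).2).trans ?_
          rw [inf_sup_right, inf_assoc v, compl_inf_eq_bot, inf_bot_eq, sup_bot_eq]
          exact inf_le_left.trans inf_le_left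
        · refine (inf_le_inf_right _ (hT hc).2).trans ?_
          rw [inf_sup_right, inf_assoc u, inf_compl_eq_bot, inf_bot_eq, bot_sup_eq]
          exact inf_le_left.trans inf_le_left
      obtain ⟨a, ha, hle, ha'⟩ := ih _ (BooleanSubalgebra.inf_mem hu hv) T
        (fun c hc => ⟨(hT hc).1, hwT c hc⟩) hunc
      exact ⟨a, ha, hle.trans (inf_le_inf_sup_inf_compl u v (x β)), ha'⟩
  | limit β hlim ih =>
    obtain ⟨γ, hγ, hb'⟩ := (h.mem_limit_iff hβ hlim).1 hb
    exact ih γ hγ (hγ.trans hβ) hb'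

theorem sepEmbedded (h : IsConstruction S δ A x) (hS : S ⊆ cofOmegaOne)
    (hδ : IsLadderSystem δ) {α : Ordinal.{u}} (hα : α < ω_ 2) (hαS : α ∉ S) : SepEmbedded (A α) := by
  intro b
  obtain ⟨β, hβ, hb⟩ := h.exhaust b
  exact h.sepAt_of_mem hS hδ hα hαS hβ hb

theorem mk_le (h : IsConstruction S δ A x) {α : Ordinal.{u}} (hα : α < ω_ 2) : #(A α) ≤ ℵ₁ := by
  induction α using Ordinal.limitRecOn with
  | zero =>
    have : (A 0 : Set B).Countable := by rw [h.zero]; simp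
    exact (Cardinal.le_aleph0_iff_set_countable.2 this).trans aleph0_lt_aleph_one.le
  | add_one α ih =>
    rw [← Order.succ_eq_add_one] at hα ⊢
    have hα' := (Order.lt_succ α).trans hα
    specialize ih hα'
    let f : A α × A α → A (Order.succ α) := fun p =>
      ⟨p.1.1 ⊓ x α ⊔ p.2.1 ⊓ (x α)ᶜ, BooleanSubalgebra.sup_mem
        (BooleanSubalgebra.inf_mem (h.le_succ hα' p.1.2) (h.gen_mem_succ hα'))
        (BooleanSubalgebra.inf_mem (h.le_succ hα' p.2.2)
          (BooleanSubalgebra.compl_mem (h.gen_mem_succ hα')))⟩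
    have hf : Function.Surjective f := by
      rintro ⟨b, hb⟩
      obtain ⟨u, hu, v, hv, rfl⟩ := h.exists_eq_of_mem_succ hα' hb
      exact ⟨(⟨u, hu⟩, ⟨v, hv⟩), rfl⟩
    refine (Cardinal.mk_le_of_surjective hf).trans ?_
    rw [Cardinal.mk_prod]
    simp only [Cardinal.lift_id]
    exact (mul_le_mul' ih ih).trans (Cardinal.mul_eq_self aleph0_lt_aleph_one.le).le
  | limit α hlim ih =>
    have hU : (A α : Set B) = ⋃ β : Set.Iio α, (A β.1 : Set B) := by
      rw [h.limit α hα hlim, Set.biUnion_eq_iUnion]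
    change #(A α : Set B) ≤ ℵ₁
    rw [hU]
    exact mk_iUnion_le_aleph_one (mk_Iio_le_of_lt_omega_two hα) fun β =>
      ih β.1 β.2 (lt_trans β.2 hα)

end IsConstruction

/-! ### Closure properties of `H_χ`. -/

section Hereditary

variable {χ : Cardinal.{u}}

theorem toZFSet_mem_hereditarySets {α : Ordinal.{u}} (hα : α < χ.ord) :
    α.toZFSet ∈ hereditarySets χ :=
  ⟨α.toZFSet, (ZFSet.isOrdinal_toZFSet α).isTransitive, fun _ h => h, by
    rw [card_toZFSet]; exact lt_ord.1 hα⟩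

/-- The countable set together with transitive sets witnessing its elements is transitive, and
regularity of `χ` keeps its size below `χ`. -/
theorem exists_mem_hereditarySets_coe_eq (hreg : χ.IsRegular) (hχ : ℵ₀ < χ) {X : Set ZFSet.{u}}
    (hX : X ⊆ hereditarySets χ) (hc : X.Countable) :
    ∃ y ∈ hereditarySets χ, (y : Set ZFSet.{u}) = X := by
  rcases X.eq_empty_or_nonempty with rfl | hne
  · exact ⟨∅, ⟨∅, ZFSet.isTransitive_empty, fun _ h => h, by
      rw [ZFSet.card_empty]; exact hreg.pos⟩, ZFSet.coe_empty⟩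
  obtain ⟨f, rfl⟩ := hc.exists_eq_range hne
  choose t ht hft hcard using fun n => hX ⟨n, rfl⟩
  refine ⟨ZFSet.range f, ⟨ZFSet.range f ∪ ZFSet.iUnion t, ?_, fun z hz => ?_, ?_⟩,
    ZFSet.coe_range f⟩
  · intro z hz w hw
    rw [ZFSet.mem_union, ZFSet.mem_iUnion]
    right
    rcases ZFSet.mem_union.1 hz with h | h
    · obtain ⟨n, rfl⟩ := ZFSet.mem_range.1 h
      exact ⟨n, hft n hw⟩
    · obtain ⟨n, hn⟩ := ZFSet.mem_iUnion.1 h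
      exact ⟨n, (ht n).subset_of_mem hn hw⟩
  · exact ZFSet.mem_union.2 (Or.inl hz)
  · refine ZFSet.card_union_le.trans_lt (add_lt_of_lt hreg.aleph0_le ?_ ?_)
    · have h := ZFSet.lift_card_range_le (f := f)
      simp only [Cardinal.lift_uzero, Cardinal.mk_nat, Cardinal.lift_aleph0] at h
      exact h.trans_lt hχ
    · have h := ZFSet.lift_card_iUnion_le_sum_card (f := t)
      rw [Cardinal.lift_uzero] at h
      refine h.trans_lt (sum_lt_lift_of_isRegular hreg ?_ hcard)
      simpa using hχ

theorem aleph_one_le_mk_hereditarySets (hχ : ℵ₁ < χ) : ℵ₁ ≤ #(hereditarySets χ) := by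
  rw [← mk_Iio_omega_one.{u}]
  refine Cardinal.mk_le_of_injective (f := fun α => ⟨α.1.toZFSet,
    toZFSet_mem_hereditarySets ?_⟩) ?_
  · refine lt_trans α.2 ?_
    rw [← ord_aleph]
    exact ord_lt_ord.2 hχ
  · intro α β h
    exact Subtype.ext (toZFSet_injective (congrArg Subtype.val h))

end Hereditary

/-! ### Elementary submodels and chains of them. -/

section Submodels

variable {χ : Cardinal.{u}}

theorem IsElementarySubmodel.subset {M : Set ZFSet.{u}} (hM : IsElementarySubmodel χ M) :
    M ⊆ hereditarySets χ := by
  obtain ⟨N, rfl⟩ := hM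
  rintro _ ⟨a, _, rfl⟩
  exact a.2

theorem card_setLang_le : setLang.card ≤ ℵ₀ := by
  have h1 : Countable (Σ n, setLang.Functions n) :=
    ⟨⟨fun f => (nomatch f.2), fun f => (nomatch f.2)⟩⟩
  have h2 : Countable (Σ n, setLang.Relations n) := by
    refine ⟨⟨fun r => r.1, ?_⟩⟩
    rintro ⟨_, ⟨⟩⟩ ⟨_, ⟨⟩⟩ _
    rfl
  have : Countable setLang.Symbols := inferInstanceAs (Countable (_ ⊕ _))
  exact Cardinal.mk_le_aleph0

open FirstOrder Language in
/-- Tarski's theorem on unions of elementary chains. -/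
theorem IsElementarySubmodel.iUnion {ι : Type*} [Nonempty ι] {M : ι → Set ZFSet.{u}}
    (hdir : Directed (· ⊆ ·) M) (hM : ∀ i, IsElementarySubmodel χ (M i)) :
    IsElementarySubmodel χ (⋃ i, M i) := by
  choose N hN using hM
  let U : setLang.Substructure (hereditarySets χ) :=
    { carrier := {a | ∃ i, a ∈ N i}
      fun_mem := fun f => nomatch f }
  have hmem : ∀ i a, a ∈ N i ↔ a.1 ∈ M i := by
    intro i a
    rw [hN i]
    exact ⟨fun h => ⟨a, h, rfl⟩, by rintro ⟨b, hb, h⟩; rwa [← Subtype.ext h]⟩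
  have hU : U.IsElementary := by
    refine U.isElementary_of_exists fun n φ x a hφ => ?_
    choose k hk using fun j => (x j).2
    -- Finitely many parameters lie in one model of the family, which supplies the witness for the
    -- Tarski–Vaught test.
    obtain ⟨i, hi⟩ := hdir.finite_le k
    have hxi : ∀ j, (x j).1 ∈ N i := fun j => (hmem i _).2 (hi j ((hmem _ _).1 (hk j)))
    let y : Fin n → N i := fun j => ⟨(x j).1, hxi j⟩
    have hyx : (N i).subtype ∘ y = Subtype.val ∘ x := rfl
    have h1 : φ.ex.Realize (default : Empty → hereditarySets χ) (Subtype.val ∘ x) :=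
      BoundedFormula.realize_ex.2 ⟨a, hφ⟩
    have h2 : φ.ex.Realize (default : Empty → N i) y := by
      rw [← (N i).subtype.map_boundedFormula, hyx]
      convert h1 using 1
    obtain ⟨b, hb⟩ := BoundedFormula.realize_ex.1 h2
    refine ⟨⟨b.1, i, b.2⟩, ?_⟩
    rw [← (N i).subtype.map_boundedFormula, Fin.comp_snoc, hyx] at hb
    convert hb using 1
    rfl
  refine ⟨⟨U, hU⟩, ?_⟩
  ext z
  simp only [Set.mem_iUnion]
  constructor
  · rintro ⟨i, hi⟩
    rw [hN i] at hi
    obtain ⟨a, ha, rfl⟩ := hi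
    exact ⟨a, ⟨i, ha⟩, rfl⟩
  · rintro ⟨a, ⟨i, ha⟩, rfl⟩
    exact ⟨i, (hmem i a).1 ha⟩

/-- Every set of at most `ℵ₁` elements of `H_χ` is included in an elementary submodel that contains
countable sets cofinal among the countable subsets of the given set. -/
theorem exists_isElementarySubmodel (hreg : χ.IsRegular) (hχ : ℵ₁ < χ) {X : Set ZFSet.{u}}
    (hX : X ⊆ hereditarySets χ) (hcard : #X ≤ ℵ₁) :
    ∃ M, IsElementarySubmodel χ M ∧ #M = ℵ₁ ∧ X ⊆ M ∧ ∀ Z ⊆ X, #Z = ℵ₀ →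
      ∃ y : ZFSet.{u}, y ∈ M ∧ (y : Set ZFSet.{u}) ⊆ X ∧ #(y : Set ZFSet.{u}) = ℵ₀ ∧
        Z ⊆ (y : Set ZFSet.{u}) := by
  obtain ⟨g⟩ : Nonempty (X ↪ Set.Iio (ω_ 1 : Ordinal.{u})) := by
    rwa [← Cardinal.le_def, mk_Iio_omega_one]
  -- Initial segments of an enumeration of `X` in type at most `ω₁` are countable and, by regularity
  -- of `ω₁`, cofinal among the countable subsets of `X`.
  let Y : Set.Iio (ω_ 1 : Ordinal.{u}) → Set ZFSet.{u} := fun ξ =>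
    Subtype.val '' {z : X | g z < ξ}
  have hYX : ∀ ξ, Y ξ ⊆ X := by
    rintro ξ _ ⟨z, _, rfl⟩
    exact z.2
  have hYc : ∀ ξ, (Y ξ).Countable := by
    intro ξ
    refine Set.Countable.image ?_ _
    have : (Set.Iio ξ.1).Countable := by
      rw [← Cardinal.le_aleph0_iff_set_countable, Cardinal.mk_Iio_ordinal]
      have : ξ.1.card < ℵ₁ := by rw [← lt_ord, ord_aleph]; exact ξ.2
      rw [← Cardinal.succ_aleph0, Order.lt_succ_iff] at this
      exact Cardinal.lift_le_aleph0.2 this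
    refine Set.MapsTo.countable_of_injOn (f := fun z : X => (g z).1) (t := Set.Iio ξ.1)
      (fun z hz => hz) (fun a _ b _ h => g.injective (Subtype.ext h)) this
  choose F hFH hFY using fun ξ => exists_mem_hereditarySets_coe_eq hreg
    (aleph0_lt_aleph_one.trans hχ) ((hYX ξ).trans hX) (hYc ξ)
  let s : Set (hereditarySets χ) := {a | a.1 ∈ X ∨ a.1 ∈ Set.range F}
  have hs : #s ≤ ℵ₁ := by
    have h1 : #s ≤ #(X ∪ Set.range F : Set ZFSet.{u}) :=
      Cardinal.mk_le_of_injective (f := fun a => ⟨a.1.1, a.2⟩) fun a b h =>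
        Subtype.val_injective (Subtype.val_injective (Subtype.mk.inj h))
    have h2 : #(Set.range F) ≤ ℵ₁ := by
      rw [← mk_Iio_omega_one.{u}]
      exact Cardinal.mk_range_le
    exact h1.trans ((Cardinal.mk_union_le _ _).trans ((add_le_add hcard h2).trans
      (Cardinal.add_eq_self aleph0_lt_aleph_one.le).le))
  obtain ⟨N, hsN, hN⟩ := FirstOrder.Language.exists_elementarySubstructure_card_eq setLang s
    (ℵ₁ : Cardinal.{u + 1}) aleph0_lt_aleph_one.le (by simpa using hs)
    (by
      have := card_setLang_le.trans aleph0_lt_aleph_one.le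
      simpa using Cardinal.lift_le.{u + 1}.2 this)
    (by simpa using aleph_one_le_mk_hereditarySets hχ)
  refine ⟨_, ⟨N, rfl⟩, ?_, ?_, ?_⟩
  · rw [Cardinal.mk_image_eq Subtype.val_injective]
    simpa using hN
  · exact fun z hz => ⟨⟨z, hX hz⟩, hsN (Or.inl hz), rfl⟩
  · intro Z hZX hZ
    have hZc : Z.Countable := Cardinal.le_aleph0_iff_set_countable.1 hZ.le
    obtain ⟨ξ, hξ, hbound⟩ := exists_bound_of_countable cof_omega_one.{u}
      (s := (fun z : X => (g z).1) '' (Subtype.val ⁻¹' Z))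
      ((hZc.preimage Subtype.val_injective).image _) (by
        rintro _ ⟨z, _, rfl⟩
        exact (g z).2)
    have hZY : Z ⊆ Y ⟨ξ, hξ⟩ := fun z hz =>
      ⟨⟨z, hZX hz⟩, hbound _ ⟨⟨z, hZX hz⟩, hz, rfl⟩, rfl⟩
    refine ⟨F ⟨ξ, hξ⟩, ⟨⟨_, hFH _⟩, hsN (Or.inr ⟨_, rfl⟩), rfl⟩, ?_, ?_, ?_⟩
    · rw [hFY]
      exact hYX _
    · rw [hFY]
      exact (Cardinal.le_aleph0_iff_set_countable.2 (hYc _)).antisymm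
        (hZ ▸ Cardinal.mk_le_mk_of_subset hZY)
    · rw [hFY]
      exact hZY

/-- An increasing chain of elementary submodels with large successor steps, including prescribed
sets. -/
theorem exists_submodel_chain (hreg : χ.IsRegular) (hχ : ℵ₁ < χ)
    {P : Ordinal.{u} → Set ZFSet.{u}} (hP : ∀ η < ω_ 2, P η ⊆ hereditarySets χ ∧ #(P η) ≤ ℵ₁) :
    ∃ M : Ordinal.{u} → Set ZFSet.{u}, ∀ η < ω_ 2, IsElementarySubmodel χ (M η) ∧ #(M η) = ℵ₁ ∧
      P η ⊆ M η ∧ ∀ ζ < η, M ζ ⊆ M η ∧ ∀ Z ⊆ M ζ, #Z = ℵ₀ →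
        ∃ y : ZFSet.{u}, y ∈ M η ∧ (y : Set ZFSet.{u}) ⊆ M η ∧ #(y : Set ZFSet.{u}) = ℵ₀ ∧
          Z ⊆ (y : Set ZFSet.{u}) := by
  have hstep : ∀ X : Set ZFSet.{u}, ∃ M, X ⊆ hereditarySets χ → #X ≤ ℵ₁ →
      IsElementarySubmodel χ M ∧ #M = ℵ₁ ∧ X ⊆ M ∧ ∀ Z ⊆ X, #Z = ℵ₀ →
        ∃ y : ZFSet.{u}, y ∈ M ∧ (y : Set ZFSet.{u}) ⊆ X ∧ #(y : Set ZFSet.{u}) = ℵ₀ ∧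
          Z ⊆ (y : Set ZFSet.{u}) := by
    intro X
    by_cases h : X ⊆ hereditarySets χ ∧ #X ≤ ℵ₁
    · obtain ⟨M, hM⟩ := exists_isElementarySubmodel hreg hχ h.1 h.2
      exact ⟨M, fun _ _ => hM⟩
    · exact ⟨∅, fun h1 h2 => (h ⟨h1, h2⟩).elim⟩
  choose G hG using hstep
  -- The chain need not be continuous: at a limit, `M η` is a new model over the union of the
  -- earlier ones. The unions themselves are the good submodels.
  let M : Ordinal.{u} → Set ZFSet.{u} := WellFoundedLT.fix fun η ih =>
    G (P η ∪ ⋃ ζ : Set.Iio η, ih ζ.1 ζ.2)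
  have hM : ∀ η, M η = G (P η ∪ ⋃ ζ : Set.Iio η, M ζ.1) := fun η => WellFoundedLT.fix_eq _ η
  have key : ∀ η < ω_ 2, P η ∪ ⋃ ζ : Set.Iio η, M ζ.1 ⊆ hereditarySets χ ∧
      #(P η ∪ ⋃ ζ : Set.Iio η, M ζ.1 : Set ZFSet.{u}) ≤ ℵ₁ := by
    intro η hη
    induction η using WellFoundedLT.induction with
    | ind η ih =>
      have ih' : ∀ ζ < η, IsElementarySubmodel χ (M ζ) ∧ #(M ζ) = ℵ₁ := by
        intro ζ hζ
        obtain ⟨h1, h2⟩ := ih ζ hζ (hζ.trans hη)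
        have := hG _ h1 h2
        rw [← hM] at this
        exact ⟨this.1, this.2.1⟩
      constructor
      · exact Set.union_subset (hP η hη).1 (Set.iUnion_subset fun ζ => (ih' ζ.1 ζ.2).1.subset)
      · exact (Cardinal.mk_union_le _ _).trans ((add_le_add (hP η hη).2 (mk_iUnion_le_aleph_one
          (mk_Iio_le_of_lt_omega_two hη) fun ζ => (ih' ζ.1 ζ.2).2.le)).trans
          (Cardinal.add_eq_self aleph0_lt_aleph_one.le).le)
  refine ⟨M, fun η hη => ?_⟩
  have h := hG _ (key η hη).1 (key η hη).2
  rw [← hM] at h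
  obtain ⟨h1, h2, h3, h4⟩ := h
  refine ⟨h1, h2, Set.subset_union_left.trans h3, fun ζ hζ => ?_⟩
  have hζη : M ζ ⊆ P η ∪ ⋃ ζ : Set.Iio η, M ζ.1 := fun z hz =>
    Or.inr (Set.mem_iUnion.2 ⟨⟨ζ, hζ⟩, hz⟩)
  refine ⟨hζη.trans h3, fun Z hZ hZ' => ?_⟩
  obtain ⟨y, hy1, hy2, hy3⟩ := h4 Z (hZ.trans hζη) hZ'
  exact ⟨y, hy1, hy2.trans h3, hy3⟩

end Submodels

/-! ### Good submodels and their traces. -/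

/-- A countable subset of the union lies in some `M γ` because `ξ` has cofinality `ℵ₁`, and the next
model contains a countable set covering it. -/
theorem iUnion_mem_goodSubmodels {χ : Cardinal.{u}} {M : Ordinal.{u} → Set ZFSet.{u}}
    (hM : ∀ η < ω_ 2, IsElementarySubmodel χ (M η) ∧ #(M η) = ℵ₁ ∧
      ∀ ζ < η, M ζ ⊆ M η ∧ ∀ Z ⊆ M ζ, #Z = ℵ₀ →
        ∃ y : ZFSet.{u}, y ∈ M η ∧ (y : Set ZFSet.{u}) ⊆ M η ∧ #(y : Set ZFSet.{u}) = ℵ₀ ∧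
          Z ⊆ (y : Set ZFSet.{u}))
    {ξ : Ordinal.{u}} (hξ : ξ ∈ cofOmegaOne) :
    (⋃ η : Set.Iio ξ, M η.1) ∈ goodSubmodels χ := by
  have hlim := isSuccLimit_of_mem_cofOmegaOne hξ
  have hlt : ∀ η : Set.Iio ξ, η.1 < ω_ 2 := fun η => lt_trans η.2 hξ.1
  have : Nonempty (Set.Iio ξ) := ⟨⟨0, hlim.bot_lt⟩⟩
  have hmono : Monotone fun η : Set.Iio ξ => M η.1 := by
    intro η ζ h
    rcases (show η.1 ≤ ζ.1 from h).lt_or_eq with h | h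
    · exact ((hM _ (hlt ζ)).2.2 _ h).1
    · simp [h]
  refine ⟨IsElementarySubmodel.iUnion hmono.directed_le fun η => (hM _ (hlt η)).1, ?_, ?_⟩
  · apply le_antisymm
    · exact mk_iUnion_le_aleph_one (mk_Iio_le_of_lt_omega_two hξ.1) fun η =>
        (hM _ (hlt η)).2.1.le
    · rw [← (hM 0 (hlim.bot_lt.trans hξ.1)).2.1]
      exact Cardinal.mk_le_mk_of_subset
        (Set.subset_iUnion (fun η : Set.Iio ξ => M η.1) ⟨0, hlim.bot_lt⟩)
  · intro X hX hXcard
    have hXc : X.Countable := Cardinal.le_aleph0_iff_set_countable.1 hXcard.le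
    have hr : ∀ z : ZFSet.{u}, ∃ η < ξ, z ∈ X → z ∈ M η := by
      intro z
      by_cases hz : z ∈ X
      · obtain ⟨η, hη⟩ := Set.mem_iUnion.1 (hX hz)
        exact ⟨η.1, η.2, fun _ => hη⟩
      · exact ⟨0, hlim.bot_lt, fun h => (hz h).elim⟩
    choose r hr1 hr2 using hr
    obtain ⟨γ, hγ, hbound⟩ := exists_bound_of_countable hξ.2 (hXc.image r) (by
      rintro _ ⟨z, _, rfl⟩
      exact hr1 z)
    have hXγ : X ⊆ M γ := fun z hz => hmono (a := ⟨r z, hr1 z⟩) (b := ⟨γ, hγ⟩)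
      (hbound _ ⟨z, hz, rfl⟩).le (hr2 z hz)
    have hγ' : Order.succ γ < ξ := hlim.succ_lt hγ
    obtain ⟨y, hy1, hy2, hy3⟩ :=
      ((hM _ (hγ'.trans hξ.1)).2.2 γ (Order.lt_succ γ)).2 X hXγ hXcard
    have hsub := Set.subset_iUnion (fun η : Set.Iio ξ => M η.1) ⟨_, hγ'⟩
    exact ⟨y, hsub hy1, hy2.trans hsub, hy3⟩

/-- The good submodels whose trace on `A^S` is `A α` for a point `α` of a given stationary set
are cofinal. -/
theorem exists_goodSubmodel_trace {χ : Cardinal.{u}} (hreg : χ.IsRegular) (hχ : ℵ₁ < χ)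
    {S S' : Set Ordinal.{u}} {δ : Ordinal.{u} → Ordinal.{u} → Ordinal.{u}} {C : ZFSet.{u}}
    [BooleanAlgebra C] (hC : (C : Set ZFSet.{u}) ⊆ hereditarySets χ)
    {A : Ordinal.{u} → BooleanSubalgebra C} {x : Ordinal.{u} → C} (h : IsConstruction S δ A x)
    (hS' : S' ⊆ cofOmegaOne) (hstat : IsStationaryInOmegaTwo S')
    {X : Set ZFSet.{u}} (hX : X ⊆ hereditarySets χ) (hXcard : #X ≤ ℵ₁) :
    ∃ M ∈ goodSubmodels χ, X ⊆ M ∧ ∃ α ∈ S', (A α : Set C) = {a : C | (a : ZFSet.{u}) ∈ M} := by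
  obtain ⟨M, hM⟩ := exists_submodel_chain hreg hχ
    (P := fun η => X ∪ Subtype.val '' (A η : Set C)) fun η hη => by
      constructor
      · refine Set.union_subset hX ?_
        rintro _ ⟨a, _, rfl⟩
        exact hC a.2
      · exact (Cardinal.mk_union_le _ _).trans ((add_le_add hXcard
          (Cardinal.mk_image_le.trans (h.mk_le hη))).trans
          (Cardinal.add_eq_self aleph0_lt_aleph_one.le).le)
  choose ρ hρ hρA using h.exhaust
  -- `g η` bounds the stages of the elements captured up to `η`. Quantifying over all `ζ ≤ η` makes
  -- `g` monotone even beyond `ω₂`, where nothing is known about `M`.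
  let g : Ordinal.{u} → Ordinal.{u} := fun η =>
    sInf {γ | ∀ ζ ≤ η, ∀ a : C, a.1 ∈ M ζ → ρ a ≤ γ}
  have hne : ∀ η, {γ | ∀ ζ ≤ η, ∀ a : C, a.1 ∈ M ζ → ρ a ≤ γ}.Nonempty := fun η =>
    ⟨ω_ 2, fun _ _ a _ => (hρ a).le⟩
  have hgmono : Monotone g := fun η η' hη =>
    csInf_le_csInf' (hne η') fun γ hγ ζ hζ a ha => hγ ζ (hζ.trans hη) a ha
  have hMmono : ∀ ζ η, ζ ≤ η → η < ω_ 2 → M ζ ⊆ M η := by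
    intro ζ η hle hη
    rcases hle.lt_or_eq with hlt | rfl
    · exact ((hM η hη).2.2.2 ζ hlt).1
    · exact le_rfl
  have hg2 : ∀ η < ω_ 2, g η < ω_ 2 := by
    intro η hη
    let T : Set C := {a | a.1 ∈ M η}
    have hT : #T ≤ ℵ₁ := by
      rw [← (hM η hη).2.1]
      exact Cardinal.mk_le_of_injective (f := fun a : T => (⟨a.1.1, a.2⟩ : M η)) fun a b h =>
        Subtype.val_injective (Subtype.val_injective (Subtype.mk.inj h))
    refine (csInf_le' ?_).trans_lt (iSup_lt_omega_two hT (f := fun a : T => ρ a.1) fun a => hρ a.1)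
    intro ζ hζ a ha
    exact le_iSup_of_mk_le hT (fun a : T => ρ a.1) ⟨a, hMmono ζ η hζ hη ha⟩
  have hρg : ∀ η, ∀ a : C, a.1 ∈ M η → ρ a ≤ g η := fun η a ha =>
    csInf_mem (hne η) η le_rfl a ha
  obtain ⟨ξ, hξS, hξ⟩ := hstat (isClub_closurePoints hgmono hg2)
  have hE := hS' hξS
  have hlim := isSuccLimit_of_mem_cofOmegaOne hE
  refine ⟨⋃ η : Set.Iio ξ.1, M η.1, iUnion_mem_goodSubmodels (fun η hη =>
    ⟨(hM η hη).1, (hM η hη).2.1, (hM η hη).2.2.2⟩) hE, ?_, ξ.1, hξS, ?_⟩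
  · refine Set.Subset.trans ?_ (Set.subset_iUnion (fun η : Set.Iio ξ.1 => M η.1) ⟨0, hlim.bot_lt⟩)
    exact Set.subset_union_left.trans (hM 0 (hlim.bot_lt.trans hE.1)).2.2.1
  · ext a
    simp only [Set.mem_ofPred_eq, Set.mem_iUnion, SetLike.mem_coe]
    constructor
    · intro ha
      obtain ⟨β, hβ, ha⟩ := (h.mem_limit_iff hE.1 hlim).1 ha
      exact ⟨⟨β, hβ⟩, (hM β (hβ.trans hE.1)).2.2.1 (Or.inr ⟨a, ha, rfl⟩)⟩
    · rintro ⟨η, hη⟩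
      have hlt : ρ a < ξ.1 := (hρg η a hη).trans_lt (hξ η η.2)
      exact h.mono hlt.le hE.1 (hρA a)

/-! ### SEP and the failure of IDP. -/

namespace SetBooleanAlgebra

/-- A cardinal above which `H_χ` contains the algebra. -/
noncomputable def bound (A : SetBooleanAlgebra.{u}) : Cardinal.{u} :=
  max ℵ₁ (ZFSet.vonNeumann A.code.rank).card

theorem code_mem_hereditarySets (A : SetBooleanAlgebra.{u}) {χ : Cardinal.{u}}
    (hχ : A.bound < χ) : A.code ∈ hereditarySets χ :=
  ⟨ZFSet.vonNeumann A.code.rank, ZFSet.isTransitive_vonNeumann _, ZFSet.subset_vonNeumann_self _,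
    (le_max_right _ _).trans_lt hχ⟩

theorem carrier_subset_hereditarySets (A : SetBooleanAlgebra.{u}) {χ : Cardinal.{u}}
    (hχ : A.bound < χ) : (A.carrier : Set ZFSet.{u}) ⊆ hereditarySets χ := by
  intro a ha
  have htrans := ZFSet.isTransitive_vonNeumann A.code.rank
  -- The code is a Kuratowski pair with first entry the carrier, so the singleton of the carrier is
  -- one of its elements.
  have h1 : ({A.carrier} : ZFSet.{u}) ∈ ZFSet.vonNeumann A.code.rank := by
    refine ZFSet.subset_vonNeumann_self _ ?_
    rw [code, ZFSet.pair]
    exact ZFSet.mem_pair.2 (Or.inl rfl)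
  have h2 := htrans.subset_of_mem h1 (ZFSet.mem_singleton.2 rfl)
  have h3 := htrans.subset_of_mem h2 ha
  exact ⟨ZFSet.vonNeumann A.code.rank, htrans, htrans.subset_of_mem h3, (le_max_right _ _).trans_lt hχ⟩

theorem sep_of_isLadderAlgebra {A : SetBooleanAlgebra.{u}} {S₀ S₁ : Set Ordinal.{u}}
    {δ : Ordinal.{u} → Ordinal.{u} → Ordinal.{u}} (hS : IsStationaryPartition S₀ S₁)
    (hδ : IsLadderSystem δ) (hA : IsLadderAlgebra S₁ δ A.carrier) : A.SEP := by
  obtain ⟨F, x, h⟩ := hA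
  have hS₀ : S₀ ⊆ cofOmegaOne := hS.union_eq ▸ Set.subset_union_left
  have hS₁ : S₁ ⊆ cofOmegaOne := hS.union_eq ▸ Set.subset_union_right
  refine ⟨A.bound, fun χ hχ hreg X hX hXcard => ?_⟩
  obtain ⟨M, hM, hXM, α, hα, hFα⟩ := exists_goodSubmodel_trace hreg
    ((le_max_left _ _).trans_lt hχ) (A.carrier_subset_hereditarySets hχ) h hS₀ hS.stationary_left
    hX hXcard.le
  exact ⟨M, hM, hXM, F α, hFα, h.sepEmbedded hS₁ hδ (hS₀ hα).1
    fun hα' => Set.disjoint_left.1 hS.disjoint hα hα'⟩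

theorem not_idp_of_isLadderAlgebra {A : SetBooleanAlgebra.{u}} {S₁ : Set Ordinal.{u}}
    {δ : Ordinal.{u} → Ordinal.{u} → Ordinal.{u}} (hS : S₁ ⊆ cofOmegaOne)
    (hstat : IsStationaryInOmegaTwo S₁)
    (hδ : IsLadderSystem δ) (hA : IsLadderAlgebra S₁ δ A.carrier) : ¬ A.IDP := by
  obtain ⟨F, x, h⟩ := hA
  rintro ⟨κ, hκ⟩
  -- A successor cardinal, hence regular, above both the alleged threshold for IDP and the bound of
  -- the algebra.
  let χ := Order.succ (max κ A.bound)
  have hlt : max κ A.bound < χ := Order.lt_succ _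
  have hb : A.bound < χ := (le_max_right _ _).trans_lt hlt
  have hreg : χ.IsRegular := isRegular_succ
    (aleph0_lt_aleph_one.le.trans ((le_max_left _ _).trans (le_max_right _ _)))
  obtain ⟨M, hM, hXM, α, hα, hFα⟩ := exists_goodSubmodel_trace hreg
    ((le_max_left _ _).trans_lt hb) (A.carrier_subset_hereditarySets hb) h hS hstat
    (X := {A.code}) (Set.singleton_subset_iff.2 (A.code_mem_hereditarySets hb))
    (by rw [Cardinal.mk_singleton]; exact one_lt_aleph0.le.trans aleph0_lt_aleph_one.le)
  obtain ⟨N, hN, hsig⟩ := hκ χ ((le_max_left _ _).trans_lt hlt) hreg M hM (hXM rfl)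
  rw [← hFα, SetLike.coe_set_eq] at hN
  exact h.not_sigmaEmbedded hS hδ hα (hN ▸ hsig)

end SetBooleanAlgebra

theorem theorem6p4 :
    (∃ A : SetBooleanAlgebra.{u}, A.SEP ∧ ¬ A.IDP) ∧
    (∃ S₀ S₁ : Set Ordinal.{u}, IsStationaryPartition S₀ S₁) ∧
    (∃ δ : Ordinal.{u} → Ordinal.{u} → Ordinal.{u}, IsLadderSystem δ) ∧
    ∀ (S₀ S₁ : Set Ordinal.{u}) (δ : Ordinal.{u} → Ordinal.{u} → Ordinal.{u}),
      IsStationaryPartition S₀ S₁ → IsLadderSystem δ →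
        (∃ A : SetBooleanAlgebra.{u}, IsLadderAlgebra S₁ δ A.carrier) ∧
        ∀ A : SetBooleanAlgebra.{u}, IsLadderAlgebra S₁ δ A.carrier → A.SEP ∧ ¬ A.IDP := by
  have main : ∀ (S₀ S₁ : Set Ordinal.{u}) (δ : Ordinal.{u} → Ordinal.{u} → Ordinal.{u}),
      IsStationaryPartition S₀ S₁ → IsLadderSystem δ →
        (∃ A : SetBooleanAlgebra.{u}, IsLadderAlgebra S₁ δ A.carrier) ∧
        ∀ A : SetBooleanAlgebra.{u}, IsLadderAlgebra S₁ δ A.carrier → A.SEP ∧ ¬ A.IDP := by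
    intro S₀ S₁ δ hS hδ
    have hS₁ : S₁ ⊆ cofOmegaOne := hS.union_eq ▸ Set.subset_union_right
    exact ⟨exists_isLadderAlgebra hS₁ hδ, fun A hA =>
      ⟨SetBooleanAlgebra.sep_of_isLadderAlgebra hS hδ hA,
        SetBooleanAlgebra.not_idp_of_isLadderAlgebra hS₁ hS.stationary_right hδ hA⟩⟩
  obtain ⟨S₀, S₁, hS⟩ := exists_isStationaryPartition.{u}
  obtain ⟨δ, hδ⟩ := exists_isLadderSystem.{u}
  obtain ⟨⟨A, hA⟩, hall⟩ := main S₀ S₁ δ hS hδ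
  exact ⟨⟨A, hall A hA⟩, ⟨S₀, S₁, hS⟩, ⟨δ, hδ⟩, main⟩
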